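/- Let $a_1,a_2,a_3\in\mathbb R^3$ be linearly independent, $\Gamma_3=\{n_1a_1+n_2a_2+n_3a_3: n\in\mathbb Z^3\}$, and let $T_3=\mathbb R^3/\Gamma_3$ be the torus with Lebesgue measure, of total volume $|T_3|$. Let $\hbar,m,e>0$ and $N\in\mathbb N$, let $\rho_j^{\rm per}\in L^1(T_3)\cap L^2(T_3)$, $j=1,\dots,N$, be real-valued, and assume $Z:=\frac1e\sum_{j=1}^N\int_{T_3}\rho_j^{\rm per}\,dx>0$. Let $H^s$ denote the complex Sobolev space on $T_3$ and put $$\mathcal M=M\times T_3^N,\qquad M=\Big\{\psi\in H^1:\int_{T_3}|\psi|^2dx=Z\Big\}.$$ For $(\psi,\overline x)\in\mathcal M$, $\overline x=(x_1,\dots,x_N)$, let $\sigma(x)=\sum_{j}\rho_j^{\rm per}(x-x_j)$, $\rho(x)=\sigma(x)-e|\psi(x)|^2$, and define the energy per cell $$E(\psi,\overline x)=\int_{T_3}\Big[\frac{\hbar^2}{2m}|\nabla\psi|^2+\frac12\,\rho\,(-\Delta)^{-1}\rho\Big]dx,\qquad (-\Delta)^{-1}\rho(x)=\frac1{\sqrt{|T_3|}}\sum_{k\in\Gamma_3^*\setminus0}\frac{\hat\rho(k)}{|k|^2}e^{-ik\cdot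 x},$$ where $\hat\rho(k)=|T_3|^{-1/2}\int_{T_3}e^{ik\cdot x}\rho(x)\,dx$, $\Gamma_3^*=\{n_1b_1+n_2b_2+n_3b_3:n\in\mathbb Z^3\}$ and $b_k\cdot a_l=2\pi\delta_{kl}$. Then: i) $E$ attains its minimum on $\mathcal M$: there is $(\psi^0,\overline x^0)\in\mathcal M$ with $E(\psi^0,\overline x^0)=\inf_{\mathcal M}E$. ii) Every such minimiser $(\psi^0,\overline x^0)$ satisfies $\psi^0\in H^2$, and there are a real-valued potential $\phi^0\in H^2$ and a frequency $\omega^0\in\mathbb R$ such that, on $T_3$ and with derivatives in the sense of distributions, $$\hbar\omega^0\psi^0=-\frac{\hbar^2}{2m}\Delta\psi^0-e\phi^0\psi^0,$$ $$-\Delta\phi^0=\sum_{j=1}^N\rho_j^{\rm per}(x-x_j^0)-e|\psi^0|^2,$$ $$0=-\int_{T_3}\nabla\phi^0(x)\,\rho_j^{\rm per}(x-x_j^0)\,dx,\qquad j=1,\dots,N.$$ -/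

import Mathlib

open MeasureTheory
open scoped ContDiff InnerProductSpace

noncomputable section

namespace Crystal

/-- The space `ℝ³`. -/
abbrev Space : Type := EuclideanSpace ℝ (Fin 3)

/-- The lattice `Γ₃ = {a₁ n¹ + a₂ n² + a₃ n³ : n ∈ ℤ³}` with periods `a₁, a₂, a₃`. -/
abbrev lattice (a : Module.Basis (Fin 3) ℝ Space) : AddSubgroup Space :=
  (Submodule.span ℤ (Set.range a)).toAddSubgroup

/-- The torus `T₃ = ℝ³ / Γ₃`. -/
abbrev Torus (a : Module.Basis (Fin 3) ℝ Space) : Type := Space ⧸ lattice a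

variable (a : Module.Basis (Fin 3) ℝ Space)

/-- The projection `ℝ³ → T₃`. -/
def proj (y : Space) : Torus a := QuotientAddGroup.mk y

/-- The Lebesgue measure of the torus: the image of the Lebesgue measure on the parallelepiped
spanned by the periods. -/
def cellMeasure : Measure (Torus a) :=
  (volume.restrict (ZSpan.fundamentalDomain a)).map (proj a)

/-- The volume `|T₃|`. -/
def cellVolume : ℝ := (cellMeasure a).real Set.univ

/-! ### Distributional derivatives and Sobolev spaces on the torus -/

/-- The classical partial derivative `∂ⱼ f` of a function on the torus. -/
def partialDeriv (j : Fin 3) (f : Torus a → ℂ) (x : Torus a) : ℂ :=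
  deriv (fun t : ℝ => f (x + proj a (t • EuclideanSpace.single j (1 : ℝ)))) 0

/-- `θ ∈ C^∞(T₃)`. -/
def IsTestFunction (θ : Torus a → ℂ) : Prop :=
  ContDiff ℝ ∞ (fun y : Space => θ (proj a y))

/-- The integrable function `g` is the distributional derivative `∂ⱼ u` of the integrable
function `u` on the torus. -/
def HasWeakPartial (j : Fin 3) (u g : Torus a → ℂ) : Prop :=
  Integrable u (cellMeasure a) ∧ Integrable g (cellMeasure a) ∧
    ∀ θ : Torus a → ℂ, IsTestFunction a θ →
      ∫ x, u x * partialDeriv a j θ x ∂(cellMeasure a) = -∫ x, g x * θ x ∂(cellMeasure a)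

/-- `u ∈ Hⁿ(T₃)`, the complex Sobolev space: all distributional derivatives of `u` of order at most
`n` are in `L²(T₃)`. -/
def MemSobolev : ℕ → (Torus a → ℂ) → Prop
  | 0, u => MemLp u 2 (cellMeasure a)
  | n + 1, u => MemLp u 2 (cellMeasure a) ∧
      ∀ j : Fin 3, ∃ g : Torus a → ℂ, HasWeakPartial a j u g ∧ MemSobolev n g

open Classical in
/-- The distributional derivative `∂ⱼ u` as a function (unique almost everywhere), if it is one. -/
def weakPartial (j : Fin 3) (u : Torus a → ℂ) : Torus a → ℂ :=
  if h : ∃ g : Torus a → ℂ, HasWeakPartial a j u g then h.choose else 0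

/-- The distributional Laplacian `Δ u = ∑ⱼ ∂ⱼ ∂ⱼ u`. -/
def weakLaplacian (u : Torus a → ℂ) (x : Torus a) : ℂ :=
  ∑ j : Fin 3, weakPartial a j (weakPartial a j u) x

/-! ### Fourier series and the inverse Laplacian -/

/-- The dual basis `b₁, b₂, b₃`, with `bᵢ · aⱼ = 2π δᵢⱼ`. -/
def dualVector (i : Fin 3) : Space :=
  (2 * Real.pi) • (InnerProductSpace.toDual ℝ Space).symm
    (LinearMap.toContinuousLinearMap (a.coord i))

theorem inner_dualVector (i j : Fin 3) :
    ⟪dualVector a i, a j⟫_ℝ = if i = j then 2 * Real.pi else 0 := by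
  simp [dualVector, inner_smul_left, Finsupp.single_apply, eq_comm]

/-- The vector `k(n) = b₁ n₁ + b₂ n₂ + b₃ n₃` of the dual lattice `Γ₃*`. -/
def dualPoint (n : Fin 3 → ℤ) : Space := ∑ i, (n i : ℝ) • dualVector a i

/-- The function `x ↦ exp (i k(n) · x)` on the torus; by `wave_proj` it does not depend on the
representative of `x`. -/
def wave (n : Fin 3 → ℤ) (x : Torus a) : ℂ :=
  Complex.exp (Complex.I * ((⟪dualPoint a n, Quotient.out x⟫_ℝ : ℝ) : ℂ))

theorem inner_dualPoint (n : Fin 3 → ℤ) {y : Space} (hy : y ∈ lattice a) :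
    ∃ m : ℤ, ⟪dualPoint a n, y⟫_ℝ = m * (2 * Real.pi) := by
  change y ∈ Submodule.span ℤ (Set.range a) at hy
  induction hy using Submodule.span_induction with
  | mem x hx =>
    obtain ⟨j, rfl⟩ := hx
    refine ⟨n j, ?_⟩
    simp [dualPoint, sum_inner, inner_smul_left, inner_dualVector]
  | zero => exact ⟨0, by simp⟩
  | add x y _ _ hx hy =>
    obtain ⟨p, hp⟩ := hx
    obtain ⟨q, hq⟩ := hy
    exact ⟨p + q, by rw [inner_add_right, hp, hq]; push_cast; ring⟩
  | smul c x _ hx =>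
    obtain ⟨p, hp⟩ := hx
    refine ⟨c * p, ?_⟩
    rw [← Int.cast_smul_eq_zsmul ℝ c x, inner_smul_right, hp]
    push_cast
    ring

theorem wave_proj (n : Fin 3 → ℤ) (y : Space) :
    wave a n (proj a y) = Complex.exp (Complex.I * ((⟪dualPoint a n, y⟫_ℝ : ℝ) : ℂ)) := by
  have h : -Quotient.out (proj a y) + y ∈ lattice a :=
    QuotientAddGroup.eq.mp (Quotient.out_eq (proj a y))
  obtain ⟨m, hm⟩ := inner_dualPoint a n h
  rw [inner_add_right, inner_neg_right] at hm
  have h2 : ⟪dualPoint a n, y⟫_ℝ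
      = ⟪dualPoint a n, Quotient.out (proj a y)⟫_ℝ + m * (2 * Real.pi) := by linarith
  rw [wave, Complex.exp_eq_exp_iff_exists_int]
  refine ⟨-m, ?_⟩
  rw [h2]
  push_cast
  ring

/-- The Fourier coefficient `ρ̂(k) = |T₃|^{-1/2} ∫ exp (i k · x) ρ(x) dx` at `k = k(n)`. -/
def fourierCoeff (ρ : Torus a → ℝ) (n : Fin 3 → ℤ) : ℂ :=
  (1 / (Real.sqrt (cellVolume a) : ℂ)) * ∫ x, wave a n x * (ρ x : ℂ) ∂(cellMeasure a)

/-- The potential `(-Δ)⁻¹ ρ (x) = |T₃|^{-1/2} ∑_{k ∈ Γ₃* \ 0} ρ̂(k) / k² exp (-i k · x)`. -/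
def invNegLaplacian (ρ : Torus a → ℝ) (x : Torus a) : ℂ :=
  (1 / (Real.sqrt (cellVolume a) : ℂ)) *
    ∑' n : {n : Fin 3 → ℤ // n ≠ 0},
      fourierCoeff a ρ n.1 / ((‖dualPoint a n.1‖ ^ 2 : ℝ) : ℂ) * wave a (-n.1) x

/-! ### The energy per cell and the stationary equations -/

variable {a} {N : ℕ}

/-- The charge density of the ions, `σ(x) = ∑ⱼ ρⱼᵖᵉʳ(x - xⱼ)`. -/
def ionDensity (ρper : Fin N → Torus a → ℝ) (X : Fin N → Torus a) (x : Torus a) : ℝ :=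
  ∑ j, ρper j (x - X j)

/-- The total charge density, `ρ(x) = σ(x) - e |ψ(x)|²`. -/
def chargeDensity (e : ℝ) (ρper : Fin N → Torus a → ℝ) (ψ : Torus a → ℂ) (X : Fin N → Torus a)
    (x : Torus a) : ℝ :=
  ionDensity ρper X x - e * ‖ψ x‖ ^ 2

/-- The energy per cell `E(ψ, X) = ∫ [ħ²/(2m) |∇ψ|² + ½ φ ρ] dx`, where `φ = (-Δ)⁻¹ ρ` (which
is real as `ρ` is). -/
def energy (ħ m e : ℝ) (ρper : Fin N → Torus a → ℝ) (ψ : Torus a → ℂ) (X : Fin N → Torus a) : ℝ :=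
  ∫ x, (ħ ^ 2 / (2 * m) * ∑ j : Fin 3, ‖weakPartial a j ψ x‖ ^ 2
      + 1 / 2 * (invNegLaplacian a (chargeDensity e ρper ψ X) x).re * chargeDensity e ρper ψ X x)
    ∂(cellMeasure a)

/-- `Z = ∑ⱼ Zⱼ` with `Zⱼ = ∫ ρⱼᵖᵉʳ dx / e`. -/
def totalZ (e : ℝ) (ρper : Fin N → Torus a → ℝ) : ℝ :=
  ∑ j, (∫ x, ρper j x ∂(cellMeasure a)) / e

/-- The set `M × T₃ᴺ` with `M = {ψ ∈ H¹ : ∫ |ψ|² dx = Z}`. -/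
def configurations (a : Module.Basis (Fin 3) ℝ Space) (N : ℕ) (Z : ℝ) :
    Set ((Torus a → ℂ) × (Fin N → Torus a)) :=
  {p | MemSobolev a 1 p.1 ∧ ∫ x, ‖p.1 x‖ ^ 2 ∂(cellMeasure a) = Z}

/-- `(ψ, X)` minimises the energy per cell over `M × T₃ᴺ`. -/
def IsMinimiser (ħ m e : ℝ) (ρper : Fin N → Torus a → ℝ) (ψ : Torus a → ℂ)
    (X : Fin N → Torus a) : Prop :=
  (ψ, X) ∈ configurations a N (totalZ e ρper) ∧
    ∀ p ∈ configurations a N (totalZ e ρper), energy ħ m e ρper ψ X ≤ energy ħ m e ρper p.1 p.2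

/-- The Schrödinger equation `ħ freq ψ = -ħ²/(2m) Δψ - e φ ψ` on the torus. -/
def SchrodingerEq (ħ m e freq : ℝ) (φ : Torus a → ℝ) (ψ : Torus a → ℂ) : Prop :=
  ∀ᵐ x ∂(cellMeasure a), (ħ * freq : ℂ) * ψ x
    = -((ħ : ℂ) ^ 2 / (2 * m)) * weakLaplacian a ψ x - e * φ x * ψ x

/-- The Poisson equation `-Δφ = ρ` on the torus. -/
def PoissonEq (φ ρ : Torus a → ℝ) : Prop :=
  ∀ᵐ x ∂(cellMeasure a), -weakLaplacian a (fun y => (φ y : ℂ)) x = (ρ x : ℂ)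

/-- The stationary Newton equations `0 = -⟨∇φ, ρⱼᵖᵉʳ(· - xⱼ)⟩`, `j = 1, …, N`. -/
def NewtonEq (φ : Torus a → ℝ) (ρper : Fin N → Torus a → ℝ) (X : Fin N → Torus a) : Prop :=
  ∀ (j : Fin N) (i : Fin 3),
    0 = -∫ x, weakPartial a i (fun y => (φ y : ℂ)) x * (ρper j (x - X j) : ℂ) ∂(cellMeasure a)

end Crystal

end

open MeasureTheory
open scoped ContDiff InnerProductSpace

noncomputable section

namespace Crystal

/-! ### The torus and its measure -/

section Torus

variable (a : Module.Basis (Fin 3) ℝ Space)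

/-! The argument runs on the Fourier side. The plane waves form a Hilbert basis of `L²` of the torus
(`waveBasis`), weak derivatives multiply the coefficients by `-i kⱼ`, and `H¹` becomes a weighted
`ℓ²` condition (`memSobolev_one_iff`). By `hasSum_energy`, volume times energy is a series of
nonnegative terms `ħ²/(2m) |k|² |ψ̂|² + |ρ̂|² / (2|k|²)`, with unnormalised coefficients. The
Coulomb term is under control because `|ψ|² ∈ L²` for `ψ ∈ H¹` (`memLp_norm_sq`): Cauchy-Schwarz on
the convolution `∑ conj ψ̂(l) ψ̂(l+n)` reduces this to `∑ |k|⁻⁴ < ∞`, true in dimension three. The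
same sum makes the potential of an `L²` charge absolutely convergent in Fourier series, hence
continuous. Existence is the direct method (`exists_energy_le_of_tendsto`). Bounded energy bounds
the gradients, so a minimising sequence has coefficientwise limits; the weight `1 + |k|² → ∞`
upgrades these to strong `L²` convergence, which preserves the constraint and gives convergence of
every charge coefficient. The ion positions lie in a compact torus. Lower semicontinuity is Fatou's
lemma for the energy series. Stationarity comes from two families of variations. Translating one ion
leaves its self-energy fixed and changes only a cross term, differentiable termwise in Fourier
series even for merely square integrable charges (`force_eq_zero`). Adding `t z` times one plane
wave to `ψ` and rescaling back to the sphere gives an explicit rational function of `t`; its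
critical point at `0`, for all complex `z`, is one Fourier coefficient of the Schrödinger equation
(`schrodinger_coeff`). That identity makes `|k|² ψ̂` square summable, so `ψ ∈ H²`. Poisson's
equation holds because the choice of `Z` makes the cell neutral. -/

theorem continuous_proj : Continuous (proj a) := continuous_quotient_mk'

theorem measurable_proj : Measurable (proj a) := (continuous_proj a).measurable

theorem proj_surjective : Function.Surjective (proj a) := QuotientAddGroup.mk_surjective

theorem isQuotientMap_proj : Topology.IsQuotientMap (proj a) := isQuotientMap_quotient_mk'

@[simp] theorem proj_add (x y : Space) : proj a (x + y) = proj a x + proj a y := rfl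

@[simp] theorem proj_neg (x : Space) : proj a (-x) = -proj a x := rfl

@[simp] theorem proj_zero : proj a 0 = 0 := rfl

/-- The bounded fundamental parallelepiped has compact closure and meets every coset, through the
fractional part. -/
instance : CompactSpace (Torus a) := by
  have hK : IsCompact (closure (ZSpan.fundamentalDomain a)) :=
    (ZSpan.fundamentalDomain_isBounded a).isCompact_closure
  refine ⟨?_⟩
  have h : proj a '' closure (ZSpan.fundamentalDomain a) = Set.univ := by
    refine Set.eq_univ_of_forall fun x => ?_
    obtain ⟨y, rfl⟩ := proj_surjective a x
    refine ⟨ZSpan.fract a y, subset_closure (ZSpan.fract_mem_fundamentalDomain a y), ?_⟩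
    refine QuotientAddGroup.eq.mpr ?_
    change -ZSpan.fract a y + y ∈ Submodule.span ℤ (Set.range a)
    have : -ZSpan.fract a y + y = (ZSpan.floor a y : Space) := by
      rw [ZSpan.fract_apply]; abel
    rw [this]
    exact SetLike.coe_mem _
  rw [← h]
  exact hK.image (continuous_proj a)

theorem cellMeasure_apply {A : Set (Torus a)} (hA : MeasurableSet A) :
    cellMeasure a A = volume (proj a ⁻¹' A ∩ ZSpan.fundamentalDomain a) := by
  rw [cellMeasure, Measure.map_apply (measurable_proj a) hA,
    Measure.restrict_apply (measurable_proj a hA)]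

instance : IsFiniteMeasure (cellMeasure a) := by
  refine ⟨?_⟩
  rw [cellMeasure_apply a MeasurableSet.univ, Set.preimage_univ, Set.univ_inter]
  exact (ZSpan.fundamentalDomain_isBounded a).measure_lt_top

-- A translate of the fundamental parallelepiped is again a fundamental domain, and a
-- lattice-periodic set has the same measure in any two fundamental domains.
open scoped Pointwise in
instance : (cellMeasure a).IsAddLeftInvariant := by
  refine ⟨fun c => ?_⟩
  obtain ⟨y, rfl⟩ := proj_surjective a c
  ext A hA
  have : Countable (lattice a) :=
    inferInstanceAs (Countable (Submodule.span ℤ (Set.range a)))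
  have hF := ZSpan.isAddFundamentalDomain' a (volume : Measure Space)
  have hF' : IsAddFundamentalDomain (lattice a) (y +ᵥ ZSpan.fundamentalDomain a)
      (volume : Measure Space) := hF.vadd_of_comm y
  rw [Measure.map_apply (measurable_const_add _) hA, cellMeasure_apply a hA,
    cellMeasure_apply a (measurable_const_add (proj a y) hA)]
  have h1 : proj a ⁻¹' ((fun x => proj a y + x) ⁻¹' A) ∩ ZSpan.fundamentalDomain a
      = (fun x => y + x) ⁻¹' (proj a ⁻¹' A ∩ (y +ᵥ ZSpan.fundamentalDomain a)) := by
    ext x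
    simp [Set.mem_vadd_set_iff_neg_vadd_mem]
  rw [h1, measure_preimage_add]
  refine (hF.measure_set_eq hF' (measurable_proj a hA) fun g => ?_).symm
  ext x
  have : proj a (g +ᵥ x) = proj a x := by
    refine QuotientAddGroup.eq.mpr ?_
    have : -(g +ᵥ x) + x = -(g : Space) := by
      change -((g : Space) + x) + x = _
      abel
    rw [this]
    exact neg_mem g.2
  simp only [Set.mem_preimage, this]

theorem cellVolume_pos : 0 < cellVolume a := by
  rw [cellVolume, measureReal_def, ENNReal.toReal_pos_iff]
  refine ⟨?_, measure_lt_top _ _⟩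
  rw [cellMeasure_apply a MeasurableSet.univ, Set.preimage_univ, Set.univ_inter]
  exact pos_iff_ne_zero.mpr (ZSpan.measure_fundamentalDomain_ne_zero a)

end Torus

/-! ### Plane waves -/

section Wave

variable (a : Module.Basis (Fin 3) ℝ Space)

theorem continuous_wave (n : Fin 3 → ℤ) : Continuous (wave a n) := by
  refine (isQuotientMap_proj a).continuous_iff.mpr ?_
  have : wave a n ∘ proj a
      = fun y => Complex.exp (Complex.I * ((⟪dualPoint a n, y⟫_ℝ : ℝ) : ℂ)) :=
    funext fun y => wave_proj a n y
  rw [this]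
  fun_prop

theorem dualPoint_add (n l : Fin 3 → ℤ) :
    dualPoint a (n + l) = dualPoint a n + dualPoint a l := by
  simp [dualPoint, add_smul, Finset.sum_add_distrib]

theorem dualPoint_neg (n : Fin 3 → ℤ) : dualPoint a (-n) = -dualPoint a n := by
  simp [dualPoint, neg_smul]

@[simp] theorem dualPoint_zero : dualPoint a 0 = 0 := by simp [dualPoint]

@[simp] theorem wave_zero (x : Torus a) : wave a 0 x = 1 := by simp [wave]

theorem wave_add (n l : Fin 3 → ℤ) (x : Torus a) :
    wave a (n + l) x = wave a n x * wave a l x := by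
  rw [wave, wave, wave, ← Complex.exp_add, dualPoint_add, inner_add_left]
  push_cast
  ring_nf

theorem norm_wave (n : Fin 3 → ℤ) (x : Torus a) : ‖wave a n x‖ = 1 := by
  rw [wave, mul_comm, Complex.norm_exp_ofReal_mul_I]

theorem wave_neg (n : Fin 3 → ℤ) (x : Torus a) :
    wave a (-n) x = starRingEnd ℂ (wave a n x) := by
  rw [wave, wave, ← Complex.exp_conj, dualPoint_neg, inner_neg_left]
  simp

theorem wave_apply_add (n : Fin 3 → ℤ) (x y : Torus a) :
    wave a n (x + y) = wave a n x * wave a n y := by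
  obtain ⟨x, rfl⟩ := proj_surjective a x
  obtain ⟨y, rfl⟩ := proj_surjective a y
  rw [← proj_add, wave_proj, wave_proj, wave_proj, ← Complex.exp_add, inner_add_right]
  push_cast
  ring_nf

@[simp] theorem wave_apply_zero (n : Fin 3 → ℤ) : wave a n 0 = 1 := by
  rw [← proj_zero, wave_proj]
  simp

theorem inner_dualPoint_smul_basis (n : Fin 3 → ℤ) (t : ℝ) (j : Fin 3) :
    ⟪dualPoint a n, t • a j⟫_ℝ = t * (n j * (2 * Real.pi)) := by
  simp [dualPoint, sum_inner, inner_smul_left, inner_smul_right, inner_dualVector]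

/-- Moving by `aⱼ / (2 nⱼ)` along a period with `nⱼ ≠ 0` changes the phase by exactly `π`. -/
theorem exists_wave_eq_neg_one {n : Fin 3 → ℤ} (hn : n ≠ 0) : ∃ c : Torus a, wave a n c = -1 := by
  obtain ⟨j, hj⟩ := Function.ne_iff.mp hn
  have hj' : (n j : ℝ) ≠ 0 := by exact_mod_cast hj
  refine ⟨proj a ((1 / (2 * (n j : ℝ))) • a j), ?_⟩
  rw [wave_proj, inner_dualPoint_smul_basis]
  have : 1 / (2 * (n j : ℝ)) * (n j * (2 * Real.pi)) = Real.pi := by field_simp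
  rw [this, mul_comm, Complex.exp_pi_mul_I]

/-- For `n ≠ 0`, translation by a point where the wave is `-1` changes the sign of the integral,
while invariance of the measure preserves it. -/
theorem integral_wave (n : Fin 3 → ℤ) :
    ∫ x, wave a n x ∂(cellMeasure a) = if n = 0 then (cellVolume a : ℂ) else 0 := by
  split_ifs with hn
  · subst hn
    simp [cellVolume]
  · obtain ⟨c, hc⟩ := exists_wave_eq_neg_one a hn
    have h := integral_add_left_eq_self (μ := cellMeasure a) (wave a n) c
    simp only [wave_apply_add, hc, neg_one_mul] at h
    rw [integral_neg] at h
    exact self_eq_neg.mp h.symm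

theorem dualPoint_ne_zero {n : Fin 3 → ℤ} (hn : n ≠ 0) : dualPoint a n ≠ 0 := by
  intro h
  obtain ⟨c, hc⟩ := exists_wave_eq_neg_one a hn
  rw [wave, h] at hc
  norm_num at hc

theorem dualPoint_injective : Function.Injective (dualPoint a) := by
  intro n l h
  by_contra hne
  refine dualPoint_ne_zero a (sub_ne_zero.mpr hne) ?_
  rw [sub_eq_add_neg, dualPoint_add, dualPoint_neg, h, add_neg_cancel]

/-- The plane wave as a continuous map. -/
def waveC (n : Fin 3 → ℤ) : C(Torus a, ℂ) := ⟨wave a n, continuous_wave a n⟩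

/-- The star algebra of trigonometric polynomials. -/
def trigAlgebra : StarSubalgebra ℂ C(Torus a, ℂ) where
  toSubalgebra := Algebra.adjoin ℂ (Set.range (waveC a))
  star_mem' := by
    change Algebra.adjoin ℂ (Set.range (waveC a)) ≤
      star (Algebra.adjoin ℂ (Set.range (waveC a)))
    refine Algebra.adjoin_le ?_
    rintro _ ⟨n, rfl⟩
    refine Algebra.subset_adjoin ⟨-n, ?_⟩
    ext x
    simp [waveC, wave_neg]

/-- Products of plane waves are plane waves, so the linear span is already closed under
multiplication. -/
theorem trigAlgebra_coe :
    Subalgebra.toSubmodule (trigAlgebra a).toSubalgebra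
      = Submodule.span ℂ (Set.range (waveC a)) := by
  apply Algebra.adjoin_eq_span_of_subset
  refine Set.Subset.trans ?_ Submodule.subset_span
  intro f hf
  refine Submonoid.closure_induction (fun _ => id) ⟨0, ?_⟩ ?_ hf
  · ext x
    simp [waveC]
  · rintro _ _ _ _ ⟨n, rfl⟩ ⟨l, rfl⟩
    refine ⟨n + l, ?_⟩
    ext x
    simp [waveC, wave_add]

/-- The wave with index `Pi.single i 1` is `exp (2π i)` raised to the `i`-th lattice coordinate. If
it equals `1` at `x - y` for each `i`, every coordinate of the difference is an integer. -/
theorem eq_of_wave_eq {x y : Torus a} (h : ∀ n, wave a n x = wave a n y) : x = y := by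
  have hz : ∀ n, wave a n (-y + x) = 1 := fun n => by
    rw [wave_apply_add, h n, ← wave_apply_add, neg_add_cancel, wave_apply_zero]
  suffices -y + x = 0 by rwa [neg_add_eq_zero, eq_comm] at this
  obtain ⟨z, hzy⟩ := proj_surjective a (-y + x)
  rw [← hzy] at hz ⊢
  refine (QuotientAddGroup.eq_zero_iff z).mpr ?_
  change z ∈ Submodule.span ℤ (Set.range a)
  rw [a.mem_span_iff_repr_mem ℤ]
  intro i
  have h1 := hz (Pi.single i 1)
  rw [wave_proj, Complex.exp_eq_one_iff] at h1
  obtain ⟨p, hp⟩ := h1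
  have h2 : ⟪dualPoint a (Pi.single i 1), z⟫_ℝ = 2 * Real.pi * a.repr z i := by
    have : dualPoint a (Pi.single i 1) = dualVector a i := by
      simp [dualPoint, Pi.single_apply]
    rw [this, dualVector, inner_smul_left]
    simp
  rw [h2] at hp
  refine ⟨p, ?_⟩
  have h3 : (a.repr z i : ℂ) = p := by
    have hpi : (Real.pi : ℂ) ≠ 0 := by exact_mod_cast Real.pi_ne_zero
    have : (2 * Real.pi * Complex.I) * (a.repr z i : ℂ) = (2 * Real.pi * Complex.I) * p := by
      push_cast at hp
      linear_combination hp
    exact mul_left_cancel₀ (by simp [hpi]) this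
  have h4 : a.repr z i = p := by exact_mod_cast h3
  simp [h4]

/-- Stone-Weierstrass: the trigonometric polynomials form a star algebra separating points of a
compact space. -/
theorem span_waveC_closure_eq_top :
    (Submodule.span ℂ (Set.range (waveC a))).topologicalClosure = ⊤ := by
  rw [← trigAlgebra_coe]
  have hsep : (trigAlgebra a).SeparatesPoints := by
    intro x y hxy
    by_contra! hcon
    refine hxy (eq_of_wave_eq a fun n => ?_)
    exact hcon (wave a n) ⟨waveC a n, Algebra.subset_adjoin ⟨n, rfl⟩, rfl⟩
  have h := ContinuousMap.starSubalgebra_topologicalClosure_eq_top_of_separatesPoints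
    (trigAlgebra a) hsep
  exact congr_arg (fun S => Subalgebra.toSubmodule (StarSubalgebra.toSubalgebra S)) h

end Wave

/-! ### Fourier coefficients -/

section Fourier

open Filter Topology ComplexConjugate

variable {a : Module.Basis (Fin 3) ℝ Space}

/-- The unnormalised Fourier coefficient `∫ exp (i k(n) · x) u(x) dx`. -/
def coeff (u : Torus a → ℂ) (n : Fin 3 → ℤ) : ℂ := ∫ x, wave a n x * u x ∂(cellMeasure a)

theorem integrable_wave_mul {u : Torus a → ℂ} (hu : Integrable u (cellMeasure a))
    (n : Fin 3 → ℤ) : Integrable (fun x => wave a n x * u x) (cellMeasure a) :=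
  hu.bdd_mul (continuous_wave a n).aestronglyMeasurable
    (ae_of_all _ fun x => (norm_wave a n x).le)

theorem memLp_wave_mul {u : Torus a → ℂ} (hu : MemLp u 2 (cellMeasure a))
    (n : Fin 3 → ℤ) : MemLp (fun x => wave a n x * u x) 2 (cellMeasure a) := by
  refine hu.of_le ((continuous_wave a n).aestronglyMeasurable.mul hu.1) (ae_of_all _ fun x => ?_)
  rw [norm_mul, norm_wave, one_mul]

theorem coeff_add {u v : Torus a → ℂ} (hu : Integrable u (cellMeasure a))
    (hv : Integrable v (cellMeasure a)) (n : Fin 3 → ℤ) :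
    coeff (fun x => u x + v x) n = coeff u n + coeff v n := by
  simp only [coeff, mul_add]
  exact integral_add (integrable_wave_mul hu n) (integrable_wave_mul hv n)

theorem coeff_sub {u v : Torus a → ℂ} (hu : Integrable u (cellMeasure a))
    (hv : Integrable v (cellMeasure a)) (n : Fin 3 → ℤ) :
    coeff (fun x => u x - v x) n = coeff u n - coeff v n := by
  simp only [coeff, mul_sub]
  exact integral_sub (integrable_wave_mul hu n) (integrable_wave_mul hv n)

theorem coeff_sum {ι : Type*} (s : Finset ι) {u : ι → Torus a → ℂ}
    (hu : ∀ i ∈ s, Integrable (u i) (cellMeasure a)) (n : Fin 3 → ℤ) :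
    coeff (fun x => ∑ i ∈ s, u i x) n = ∑ i ∈ s, coeff (u i) n := by
  simp only [coeff, Finset.mul_sum]
  exact integral_finsetSum s fun i hi => integrable_wave_mul (hu i hi) n

theorem coeff_const_mul (c : ℂ) (u : Torus a → ℂ) (n : Fin 3 → ℤ) :
    coeff (fun x => c * u x) n = c * coeff u n := by
  simp only [coeff, mul_left_comm _ c]
  exact integral_const_mul c _

theorem coeff_conj (u : Torus a → ℂ) (n : Fin 3 → ℤ) :
    coeff (fun x => conj (u x)) n = conj (coeff u (-n)) := by
  rw [coeff, coeff, ← integral_conj]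
  simp [wave_neg]

theorem coeff_ofReal_neg (f : Torus a → ℝ) (n : Fin 3 → ℤ) :
    coeff (fun x => (f x : ℂ)) (-n) = conj (coeff (fun x => (f x : ℂ)) n) := by
  have := coeff_conj (fun x => (f x : ℂ)) (-n)
  simpa using this

theorem coeff_wave (n l : Fin 3 → ℤ) :
    coeff (wave a (-l)) n = if n = l then (cellVolume a : ℂ) else 0 := by
  simp only [coeff, ← wave_add, integral_wave, ← sub_eq_add_neg, sub_eq_zero]

theorem norm_coeff_le (u : Torus a → ℂ) (n : Fin 3 → ℤ) :
    ‖coeff u n‖ ≤ ∫ x, ‖u x‖ ∂(cellMeasure a) := by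
  refine (norm_integral_le_integral_norm _).trans_eq ?_
  simp [norm_wave]

/-- Integration against `g` is a bounded functional on `C(T₃)`; its kernel is closed and contains
the plane waves, whose span is dense. -/
theorem integral_continuous_mul_eq_zero {g : Torus a → ℂ} (hg : Integrable g (cellMeasure a))
    (h : ∀ n, coeff g n = 0) (f : C(Torus a, ℂ)) : ∫ x, f x * g x ∂(cellMeasure a) = 0 := by
  have hint : ∀ f : C(Torus a, ℂ), Integrable (fun x => f x * g x) (cellMeasure a) := fun f =>
    hg.bdd_mul f.continuous.aestronglyMeasurable (ae_of_all _ fun x => f.norm_coe_le_norm x)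
  let L : C(Torus a, ℂ) →ₗ[ℂ] ℂ :=
    { toFun := fun f => ∫ x, f x * g x ∂(cellMeasure a)
      map_add' := fun f₁ f₂ => by
        simp only [ContinuousMap.add_apply, add_mul]
        exact integral_add (hint f₁) (hint f₂)
      map_smul' := fun c f => by
        simp only [ContinuousMap.smul_apply, smul_eq_mul, mul_assoc, RingHom.id_apply]
        exact integral_const_mul c _ }
  let L' : C(Torus a, ℂ) →L[ℂ] ℂ := L.mkContinuous (∫ x, ‖g x‖ ∂(cellMeasure a)) fun f => by
    refine (norm_integral_le_integral_norm _).trans ?_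
    rw [mul_comm, ← integral_const_mul]
    refine integral_mono (hint f).norm (hg.norm.const_mul _) fun x => ?_
    simp only [norm_mul]
    gcongr
    exact f.norm_coe_le_norm x
  have hle : (Submodule.span ℂ (Set.range (waveC a))).topologicalClosure ≤ L'.ker := by
    refine Submodule.topologicalClosure_minimal _ ?_ L'.isClosed_ker
    rw [Submodule.span_le]
    rintro _ ⟨n, rfl⟩
    exact h n
  rw [span_waveC_closure_eq_top] at hle
  exact hle (Submodule.mem_top (x := f))

/-- An integrable function on the torus is determined by its Fourier coefficients. -/
theorem ae_eq_zero_of_coeff_eq_zero {g : Torus a → ℂ} (hg : Integrable g (cellMeasure a))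
    (h : ∀ n, coeff g n = 0) : g =ᵐ[cellMeasure a] 0 := by
  -- Integrals over closed sets suffice, and the indicator of a closed set is a bounded pointwise
  -- limit of continuous functions.
  refine ae_eq_zero_of_forall_setIntegral_isClosed_eq_zero hg fun s hs => ?_
  have hz : ∀ n : ℕ, ∫ x, (((hs.apprSeq n x : NNReal) : ℝ) : ℂ) * g x ∂(cellMeasure a) = 0 :=
    fun n => integral_continuous_mul_eq_zero hg h
      ⟨fun x => (((hs.apprSeq n x : NNReal) : ℝ) : ℂ), by fun_prop⟩
  have hlim : Tendsto
      (fun n : ℕ => ∫ x, (((hs.apprSeq n x : NNReal) : ℝ) : ℂ) * g x ∂(cellMeasure a)) atTop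
      (𝓝 (∫ x, s.indicator g x ∂(cellMeasure a))) := by
    refine tendsto_integral_of_dominated_convergence (fun x => ‖g x‖) (fun n => ?_) hg.norm
      (fun n => ae_of_all _ fun x => ?_) (ae_of_all _ fun x => ?_)
    · exact Continuous.aestronglyMeasurable (by fun_prop) |>.mul hg.1
    · rw [norm_mul]
      refine mul_le_of_le_one_left (norm_nonneg _) ?_
      simpa using HasOuterApproxClosed.apprSeq_apply_le_one hs n x
    · have h1 := tendsto_pi_nhds.mp (HasOuterApproxClosed.tendsto_apprSeq hs) x
      have h2 : Tendsto (fun n : ℕ => (((hs.apprSeq n x : NNReal) : ℝ) : ℂ)) atTop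
          (𝓝 (((s.indicator (fun _ => (1 : NNReal)) x : NNReal) : ℝ) : ℂ)) :=
        ((Complex.continuous_ofReal.comp NNReal.continuous_coe).tendsto _).comp h1
      have h3 := h2.mul_const (g x)
      convert! h3 using 2
      by_cases hx : x ∈ s <;> simp [hx]
  rw [← integral_indicator hs.measurableSet]
  exact tendsto_nhds_unique hlim (by simp only [hz, tendsto_const_nhds])

theorem ae_eq_of_coeff_eq {u v : Torus a → ℂ} (hu : Integrable u (cellMeasure a))
    (hv : Integrable v (cellMeasure a)) (h : ∀ n, coeff u n = coeff v n) :
    u =ᵐ[cellMeasure a] v := by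
  have := ae_eq_zero_of_coeff_eq_zero (hu.sub hv) fun n => by
    rw [show u - v = fun x => u x - v x from rfl, coeff_sub hu hv, h n, sub_self]
  filter_upwards [this] with x hx
  exact sub_eq_zero.mp hx

theorem sqrt_cellVolume_mul_self :
    (Real.sqrt (cellVolume a) : ℂ) * (Real.sqrt (cellVolume a) : ℂ) = cellVolume a := by
  rw [← Complex.ofReal_mul, Real.mul_self_sqrt (cellVolume_pos a).le]

theorem sqrt_cellVolume_ne_zero : (Real.sqrt (cellVolume a) : ℂ) ≠ 0 := by
  exact_mod_cast (Real.sqrt_pos.mpr (cellVolume_pos a)).ne'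

variable (a) in
theorem memLp_wave (n : Fin 3 → ℤ) (p : ENNReal) : MemLp (wave a n) p (cellMeasure a) :=
  MemLp.of_bound (continuous_wave a n).aestronglyMeasurable 1
    (ae_of_all _ fun x => (norm_wave a n x).le)

variable (a) in
/-- The normalised plane waves as elements of `L²`. -/
def waveLp (n : Fin 3 → ℤ) : Lp ℂ 2 (cellMeasure a) :=
  (1 / (Real.sqrt (cellVolume a) : ℂ)) • (memLp_wave a (-n) 2).toLp _

/-- The basis vector uses `wave a (-n)` because the inner product conjugates its first slot, which
restores `wave a n`. -/
theorem inner_waveLp (n : Fin 3 → ℤ) {u : Torus a → ℂ} (hu : MemLp u 2 (cellMeasure a)) :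
    ⟪waveLp a n, hu.toLp u⟫_ℂ = (1 / (Real.sqrt (cellVolume a) : ℂ)) * coeff u n := by
  rw [waveLp, inner_smul_left, L2.inner_def]
  congr 1
  · simp
  · refine integral_congr_ae ?_
    filter_upwards [hu.coeFn_toLp, (memLp_wave a (-n) 2).coeFn_toLp] with x h1 h2
    rw [h1, h2, wave_neg]
    simp [mul_comm]

theorem orthonormal_waveLp : Orthonormal ℂ (waveLp a) := by
  rw [orthonormal_iff_ite]
  intro n l
  conv_lhs => rw [show waveLp a l = (1 / (Real.sqrt (cellVolume a) : ℂ)) •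
    (memLp_wave a (-l) 2).toLp _ from rfl]
  rw [inner_smul_right, inner_waveLp, coeff_wave]
  have := sqrt_cellVolume_ne_zero (a := a)
  split_ifs
  · rw [← sqrt_cellVolume_mul_self]
    field_simp
  · simp

theorem span_waveLp_orthogonal : (Submodule.span ℂ (Set.range (waveLp a)))ᗮ = ⊥ := by
  refine (Submodule.eq_bot_iff _).mpr fun f hf => ?_
  have h1 : ∀ n, coeff f n = 0 := fun n => by
    have h := hf (waveLp a n) (Submodule.subset_span ⟨n, rfl⟩)
    rw [← Lp.toLp_coeFn f (Lp.memLp f), inner_waveLp] at h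
    exact (mul_eq_zero.mp h).resolve_left (one_div_ne_zero sqrt_cellVolume_ne_zero)
  exact (Lp.eq_zero_iff_ae_eq_zero).mpr
    (ae_eq_zero_of_coeff_eq_zero ((Lp.memLp f).integrable (by norm_num)) h1)

variable (a) in
/-- The Hilbert basis of normalised plane waves. -/
def waveBasis : HilbertBasis (Fin 3 → ℤ) ℂ (Lp ℂ 2 (cellMeasure a)) :=
  HilbertBasis.mkOfOrthogonalEqBot orthonormal_waveLp span_waveLp_orthogonal

theorem waveBasis_apply (n : Fin 3 → ℤ) : waveBasis a n = waveLp a n := by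
  rw [waveBasis, HilbertBasis.coe_mkOfOrthogonalEqBot]

/-- Parseval's identity. -/
theorem hasSum_conj_coeff_mul {u v : Torus a → ℂ} (hu : MemLp u 2 (cellMeasure a))
    (hv : MemLp v 2 (cellMeasure a)) :
    HasSum (fun n => conj (coeff u n) * coeff v n)
      (cellVolume a * ∫ x, conj (u x) * v x ∂(cellMeasure a)) := by
  have h := (waveBasis a).hasSum_inner_mul_inner (hu.toLp u) (hv.toLp v)
  have h0 := sqrt_cellVolume_ne_zero (a := a)
  have h2 := h.mul_left (cellVolume a : ℂ)
  convert! h2 using 1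
  · ext n
    rw [waveBasis_apply, inner_waveLp, ← inner_conj_symm, inner_waveLp,
      ← sqrt_cellVolume_mul_self]
    simp
    field_simp
  · rw [L2.inner_def]
    congr 1
    refine integral_congr_ae ?_
    filter_upwards [hu.coeFn_toLp, hv.coeFn_toLp] with x h1 h2
    rw [h1, h2]
    simp [mul_comm]

theorem conj_mul_self_eq (z : ℂ) : conj z * z = ((‖z‖ ^ 2 : ℝ) : ℂ) := by
  rw [Complex.conj_mul']
  norm_cast

theorem hasSum_norm_coeff_sq {u : Torus a → ℂ} (hu : MemLp u 2 (cellMeasure a)) :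
    HasSum (fun n => ‖coeff u n‖ ^ 2) (cellVolume a * ∫ x, ‖u x‖ ^ 2 ∂(cellMeasure a)) := by
  have h := hasSum_conj_coeff_mul hu hu
  simp only [conj_mul_self_eq] at h
  rw [integral_complex_ofReal] at h
  exact_mod_cast h

theorem summable_norm_coeff_sq {u : Torus a → ℂ} (hu : MemLp u 2 (cellMeasure a)) :
    Summable fun n => ‖coeff u n‖ ^ 2 := (hasSum_norm_coeff_sq hu).summable

/-- The Riesz-Fischer theorem. -/
theorem exists_memLp_coeff_eq {c : (Fin 3 → ℤ) → ℂ} (hc : Summable fun n => ‖c n‖ ^ 2) :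
    ∃ u : Torus a → ℂ, MemLp u 2 (cellMeasure a) ∧ ∀ n, coeff u n = c n := by
  let s : ℂ := Real.sqrt (cellVolume a)
  have hs : s ≠ 0 := sqrt_cellVolume_ne_zero
  have hd : Memℓp (fun n => 1 / s * c n) 2 := by
    refine memℓp_gen ?_
    have := hc.mul_left (‖1 / s‖ ^ 2)
    simpa [mul_pow] using this
  let f : lp (fun _ : Fin 3 → ℤ => ℂ) 2 := ⟨_, hd⟩
  refine ⟨(waveBasis a).repr.symm f, Lp.memLp _, fun n => ?_⟩
  have h := (waveBasis a).repr_apply_apply ((waveBasis a).repr.symm f) n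
  rw [LinearIsometryEquiv.apply_symm_apply, waveBasis_apply,
    ← Lp.toLp_coeFn ((waveBasis a).repr.symm f) (Lp.memLp _), inner_waveLp] at h
  exact (mul_left_cancel₀ (one_div_ne_zero hs) h).symm

end Fourier

/-! ### Weak derivatives in terms of Fourier coefficients -/

section Sobolev

open Filter Topology ComplexConjugate

variable {a : Module.Basis (Fin 3) ℝ Space}

theorem integrable_of_continuous {f : Torus a → ℂ} (hf : Continuous f) :
    Integrable f (cellMeasure a) :=
  hf.integrable_of_hasCompactSupport (HasCompactSupport.of_compactSpace f)

theorem memLp_of_continuous {f : Torus a → ℂ} (hf : Continuous f) (p : ENNReal) :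
    MemLp f p (cellMeasure a) :=
  hf.memLp_of_hasCompactSupport (HasCompactSupport.of_compactSpace f)

theorem norm_dualPoint_sq (n : Fin 3 → ℤ) :
    ‖dualPoint a n‖ ^ 2 = ∑ j, dualPoint a n j ^ 2 := by
  simp [EuclideanSpace.norm_sq_eq]

theorem hasDerivAt_wave (j : Fin 3) (n : Fin 3 → ℤ) (x : Torus a) (t : ℝ) :
    HasDerivAt (fun t : ℝ => wave a n (x + proj a (t • EuclideanSpace.single j (1 : ℝ))))
      (Complex.I * dualPoint a n j * wave a n (x + proj a (t • EuclideanSpace.single j (1 : ℝ))))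
      t := by
  have h1 : ∀ t : ℝ, wave a n (x + proj a (t • EuclideanSpace.single j (1 : ℝ)))
      = wave a n x * Complex.exp (Complex.I * dualPoint a n j * t) := fun t => by
    rw [wave_apply_add, wave_proj, inner_smul_right, EuclideanSpace.inner_single_right]
    simp only [conj_trivial]
    push_cast
    ring_nf
  have h2 : HasDerivAt (fun t : ℝ => Complex.I * dualPoint a n j * (t : ℂ))
      (Complex.I * dualPoint a n j) t := by
    simpa using (Complex.ofRealCLM.hasDerivAt (x := t)).const_mul (Complex.I * dualPoint a n j)
  rw [funext h1, h1]
  convert! (h2.cexp).const_mul (wave a n x) using 1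
  ring

theorem partialDeriv_wave (j : Fin 3) (n : Fin 3 → ℤ) (x : Torus a) :
    partialDeriv a j (wave a n) x = Complex.I * dualPoint a n j * wave a n x := by
  have h := (hasDerivAt_wave j n x 0).deriv
  rw [partialDeriv, h]
  simp

theorem isTestFunction_wave (n : Fin 3 → ℤ) : IsTestFunction a (wave a n) := by
  have : (fun y : Space => wave a n (proj a y))
      = fun y => Complex.exp (Complex.I * Complex.ofRealCLM (innerSL ℝ (dualPoint a n) y)) := by
    funext y
    rw [wave_proj]
    simp
  rw [IsTestFunction, this]
  fun_prop

theorem IsTestFunction.mul {θ η : Torus a → ℂ} (hθ : IsTestFunction a θ)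
    (hη : IsTestFunction a η) : IsTestFunction a (fun x => θ x * η x) :=
  ContDiff.mul hθ hη

theorem IsTestFunction.continuous {θ : Torus a → ℂ} (hθ : IsTestFunction a θ) :
    Continuous θ :=
  (isQuotientMap_proj a).continuous_iff.mpr (ContDiff.continuous hθ)

theorem IsTestFunction.hasDerivAt {θ : Torus a → ℂ} (hθ : IsTestFunction a θ) (j : Fin 3)
    (x : Torus a) (t : ℝ) :
    HasDerivAt (fun t : ℝ => θ (x + proj a (t • EuclideanSpace.single j (1 : ℝ))))
      (partialDeriv a j θ (x + proj a (t • EuclideanSpace.single j (1 : ℝ)))) t := by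
  obtain ⟨y, rfl⟩ := proj_surjective a x
  set v : Space := EuclideanSpace.single j (1 : ℝ)
  have key : ∀ (y : Space) (t : ℝ), HasDerivAt (fun t : ℝ => θ (proj a y + proj a (t • v)))
      (fderiv ℝ (fun y : Space => θ (proj a y)) (y + t • v) v) t := fun y t => by
    have hf : DifferentiableAt ℝ (fun y : Space => θ (proj a y)) (y + t • v) :=
      (ContDiff.differentiable hθ (by simp)).differentiableAt
    have hg : HasDerivAt (fun t : ℝ => y + t • v) v t := by
      simpa using ((hasDerivAt_id t).smul_const v).const_add y
    exact hf.hasFDerivAt.comp_hasDerivAt t hg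
  -- `partialDeriv` differentiates at time `0`, so its value at a later point is obtained by moving
  -- the base point to `y + t • v`.
  have h2 := (key (y + t • v) 0).deriv
  rw [zero_smul, add_zero] at h2
  rw [← proj_add, partialDeriv, h2]
  exact key y t

theorem IsTestFunction.continuous_partialDeriv {θ : Torus a → ℂ} (hθ : IsTestFunction a θ)
    (j : Fin 3) : Continuous (partialDeriv a j θ) := by
  refine (isQuotientMap_proj a).continuous_iff.mpr ?_
  have h : partialDeriv a j θ ∘ proj a = fun y =>
      fderiv ℝ (fun y : Space => θ (proj a y)) y (EuclideanSpace.single j (1 : ℝ)) := by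
    funext y
    have hf : DifferentiableAt ℝ (fun y : Space => θ (proj a y))
        (y + (0 : ℝ) • EuclideanSpace.single j (1 : ℝ)) :=
      (ContDiff.differentiable hθ (by simp)).differentiableAt
    have hg : HasDerivAt (fun t : ℝ => y + t • EuclideanSpace.single j (1 : ℝ))
        (EuclideanSpace.single j (1 : ℝ)) 0 := by
      simpa using ((hasDerivAt_id (0 : ℝ)).smul_const
        (EuclideanSpace.single j (1 : ℝ))).const_add y
    have := (hf.hasFDerivAt.comp_hasDerivAt 0 hg).deriv
    rw [zero_smul, add_zero] at this
    exact this
  rw [h]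
  exact (ContDiff.continuous_fderiv hθ (by simp)).clm_apply continuous_const

/-- The integral of a translate of `θ` does not depend on the translation; differentiate it under
the integral sign. -/
theorem IsTestFunction.integral_partialDeriv {θ : Torus a → ℂ} (hθ : IsTestFunction a θ)
    (j : Fin 3) : ∫ x, partialDeriv a j θ x ∂(cellMeasure a) = 0 := by
  set v : Space := EuclideanSpace.single j (1 : ℝ) with hv
  have hc := hθ.continuous_partialDeriv j
  obtain ⟨C, hC⟩ := isCompact_univ.exists_bound_of_continuousOn hc.continuousOn
  have hd := (hasDerivAt_integral_of_dominated_loc_of_deriv_le (μ := cellMeasure a)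
    (F := fun (t : ℝ) (x : Torus a) => θ (x + proj a (t • v)))
    (F' := fun (t : ℝ) (x : Torus a) => partialDeriv a j θ (x + proj a (t • v)))
    (x₀ := 0) (s := Set.univ) (bound := fun _ => C) Filter.univ_mem
    (Eventually.of_forall fun t => (hθ.continuous.comp
      (continuous_add_const _)).aestronglyMeasurable)
    (integrable_of_continuous (hθ.continuous.comp (continuous_add_const _)))
    ((hc.comp (continuous_add_const _)).aestronglyMeasurable)
    (ae_of_all _ fun x t _ => hC _ (Set.mem_univ _)) (integrable_const C)
    (ae_of_all _ fun x t _ => hθ.hasDerivAt j x t)).2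
  have hconst : (fun t : ℝ => ∫ x, θ (x + proj a (t • v)) ∂(cellMeasure a))
      = fun _ => ∫ x, θ x ∂(cellMeasure a) :=
    funext fun t => integral_add_right_eq_self θ _
  rw [hconst] at hd
  have := hd.unique (hasDerivAt_const _ _)
  simpa using this

/-- Product rule for `wave a n * θ`, whose partial derivative has integral zero. -/
theorem IsTestFunction.coeff_partialDeriv {θ : Torus a → ℂ} (hθ : IsTestFunction a θ)
    (j : Fin 3) (n : Fin 3 → ℤ) :
    coeff (partialDeriv a j θ) n = -(Complex.I * dualPoint a n j) * coeff θ n := by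
  have h := ((isTestFunction_wave n).mul hθ).integral_partialDeriv j
  have h1 : ∀ x, partialDeriv a j (fun x => wave a n x * θ x) x
      = (Complex.I * dualPoint a n j) * (wave a n x * θ x)
        + wave a n x * partialDeriv a j θ x := fun x => by
    have := ((hasDerivAt_wave j n x 0).mul (hθ.hasDerivAt j x 0)).deriv
    simp only [zero_smul, proj_zero, add_zero] at this
    rw [← mul_assoc]
    exact this
  simp only [h1] at h
  rw [integral_add ((integrable_wave_mul (integrable_of_continuous hθ.continuous) n).const_mul _)
    (integrable_wave_mul (integrable_of_continuous (hθ.continuous_partialDeriv j)) n),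
    integral_const_mul] at h
  simp only [coeff]
  linear_combination h

theorem HasWeakPartial.coeff_eq {j : Fin 3} {u g : Torus a → ℂ} (h : HasWeakPartial a j u g)
    (n : Fin 3 → ℤ) : coeff g n = -(Complex.I * dualPoint a n j) * coeff u n := by
  have h1 := h.2.2 (wave a n) (isTestFunction_wave n)
  simp only [partialDeriv_wave] at h1
  have h2 : ∫ x, u x * (Complex.I * dualPoint a n j * wave a n x) ∂(cellMeasure a)
      = (Complex.I * dualPoint a n j) * coeff u n := by
    rw [coeff, ← integral_const_mul]
    congr 1 with x
    ring
  rw [h2] at h1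
  have h3 : ∫ x, g x * wave a n x ∂(cellMeasure a) = coeff g n := by
    simp only [coeff, mul_comm]
  rw [h3] at h1
  linear_combination h1

/-- The bilinear form of Parseval's identity. -/
theorem hasSum_coeff_neg_mul {u v : Torus a → ℂ} (hu : MemLp u 2 (cellMeasure a))
    (hv : MemLp v 2 (cellMeasure a)) :
    HasSum (fun n => coeff u (-n) * coeff v n)
      (cellVolume a * ∫ x, u x * v x ∂(cellMeasure a)) := by
  have h := hasSum_conj_coeff_mul (u := fun x => conj (u x)) hu.star hv
  simpa only [coeff_conj, Complex.conj_conj] using h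

/-- Converse of `HasWeakPartial.coeff_eq` in `L²`: Parseval turns integration by parts against `θ`
into an identity between the terms of two series. -/
theorem hasWeakPartial_of_coeff {j : Fin 3} {u g : Torus a → ℂ}
    (hu : MemLp u 2 (cellMeasure a)) (hg : MemLp g 2 (cellMeasure a))
    (h : ∀ n, coeff g n = -(Complex.I * dualPoint a n j) * coeff u n) :
    HasWeakPartial a j u g := by
  refine ⟨hu.integrable (by norm_num), hg.integrable (by norm_num), fun θ hθ => ?_⟩
  have h1 := hasSum_coeff_neg_mul hu (memLp_of_continuous (hθ.continuous_partialDeriv j) 2)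
  have h2 := hasSum_coeff_neg_mul hg (memLp_of_continuous hθ.continuous 2)
  have h3 : (fun n => coeff u (-n) * coeff (partialDeriv a j θ) n)
      = fun n => -(coeff g (-n) * coeff θ n) := by
    funext n
    rw [hθ.coeff_partialDeriv, h, dualPoint_neg]
    simp only [PiLp.neg_apply, Complex.ofReal_neg]
    ring
  rw [h3] at h1
  have h4 := h1.unique h2.neg
  have hV : (cellVolume a : ℂ) ≠ 0 := by exact_mod_cast (cellVolume_pos a).ne'
  rw [← mul_neg] at h4
  exact mul_left_cancel₀ hV h4

theorem HasWeakPartial.ae_unique {j : Fin 3} {u g₁ g₂ : Torus a → ℂ}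
    (h₁ : HasWeakPartial a j u g₁) (h₂ : HasWeakPartial a j u g₂) :
    g₁ =ᵐ[cellMeasure a] g₂ :=
  ae_eq_of_coeff_eq h₁.2.1 h₂.2.1 fun n => by rw [h₁.coeff_eq, h₂.coeff_eq]

theorem HasWeakPartial.congr {j : Fin 3} {u v g : Torus a → ℂ} (h : HasWeakPartial a j u g)
    (huv : u =ᵐ[cellMeasure a] v) : HasWeakPartial a j v g := by
  refine ⟨h.1.congr huv, h.2.1, fun θ hθ => ?_⟩
  rw [← h.2.2 θ hθ]
  exact integral_congr_ae (huv.mono fun x hx => by simp only [hx])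

theorem HasWeakPartial.weakPartial {j : Fin 3} {u g : Torus a → ℂ} (h : HasWeakPartial a j u g) :
    HasWeakPartial a j u (weakPartial a j u) := by
  have hex : ∃ g, HasWeakPartial a j u g := ⟨g, h⟩
  rw [Crystal.weakPartial, dif_pos hex]
  exact hex.choose_spec

/-- The derivative selected by choice in `weakPartial` agrees almost everywhere with the square
integrable witness, so it inherits its integrability. -/
theorem memSobolev_one_weakPartial {u : Torus a → ℂ} (h : MemSobolev a 1 u) (j : Fin 3) :
    HasWeakPartial a j u (weakPartial a j u) ∧ MemLp (weakPartial a j u) 2 (cellMeasure a) := by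
  obtain ⟨g, hg, hg2⟩ := h.2 j
  exact ⟨hg.weakPartial, MemLp.ae_eq (hg.ae_unique hg.weakPartial) hg2⟩

theorem norm_partial_symbol_sq (j : Fin 3) (n : Fin 3 → ℤ) (z : ℂ) :
    ‖-(Complex.I * dualPoint a n j) * z‖ ^ 2 = dualPoint a n j ^ 2 * ‖z‖ ^ 2 := by
  simp [mul_pow]

theorem dualPoint_apply_sq_le (j : Fin 3) (n : Fin 3 → ℤ) :
    dualPoint a n j ^ 2 ≤ ‖dualPoint a n‖ ^ 2 := by
  rw [norm_dualPoint_sq]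
  exact Finset.single_le_sum (f := fun j => dualPoint a n j ^ 2) (fun i _ => sq_nonneg _)
    (Finset.mem_univ j)

/-- The `L²` norm of the gradient in terms of Fourier coefficients. -/
theorem hasSum_gradient {u : Torus a → ℂ} (h : MemSobolev a 1 u) :
    HasSum (fun n => ‖dualPoint a n‖ ^ 2 * ‖coeff u n‖ ^ 2)
      (cellVolume a * ∫ x, ∑ j, ‖weakPartial a j u x‖ ^ 2 ∂(cellMeasure a)) := by
  have h1 : ∀ j, HasSum (fun n => dualPoint a n j ^ 2 * ‖coeff u n‖ ^ 2)
      (cellVolume a * ∫ x, ‖weakPartial a j u x‖ ^ 2 ∂(cellMeasure a)) := fun j => by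
    have := hasSum_norm_coeff_sq (memSobolev_one_weakPartial h j).2
    simpa only [(memSobolev_one_weakPartial h j).1.coeff_eq, norm_partial_symbol_sq] using this
  rw [integral_finsetSum _ fun j _ => (memSobolev_one_weakPartial h j).2.integrable_norm_pow
    (by norm_num), Finset.mul_sum]
  simp only [norm_dualPoint_sq, Finset.sum_mul]
  exact hasSum_sum fun j _ => h1 j

theorem exists_hasWeakPartial {u : Torus a → ℂ} (hu : MemLp u 2 (cellMeasure a))
    (hs : Summable fun n => ‖dualPoint a n‖ ^ 2 * ‖coeff u n‖ ^ 2) (j : Fin 3) :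
    ∃ g, HasWeakPartial a j u g ∧ MemLp g 2 (cellMeasure a) := by
  obtain ⟨g, hg, hgc⟩ := exists_memLp_coeff_eq
    (c := fun n => -(Complex.I * dualPoint a n j) * coeff u n) (by
      simp only [norm_partial_symbol_sq]
      exact hs.of_nonneg_of_le (fun n => by positivity) fun n =>
        mul_le_mul_of_nonneg_right (dualPoint_apply_sq_le j n) (by positivity))
  exact ⟨g, hasWeakPartial_of_coeff hu hg hgc, hg⟩

theorem memSobolev_one_iff {u : Torus a → ℂ} :
    MemSobolev a 1 u ↔ MemLp u 2 (cellMeasure a) ∧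
      Summable fun n => ‖dualPoint a n‖ ^ 2 * ‖coeff u n‖ ^ 2 :=
  ⟨fun h => ⟨h.1, (hasSum_gradient h).summable⟩,
    fun h => ⟨h.1, fun j => exists_hasWeakPartial h.1 h.2 j⟩⟩

theorem memSobolev_two_of_summable {u : Torus a → ℂ} (hu : MemLp u 2 (cellMeasure a))
    (hs : Summable fun n => ‖dualPoint a n‖ ^ 4 * ‖coeff u n‖ ^ 2) : MemSobolev a 2 u := by
  have hs1 : Summable fun n => ‖dualPoint a n‖ ^ 2 * ‖coeff u n‖ ^ 2 := by
    refine ((summable_norm_coeff_sq hu).add hs).of_nonneg_of_le (fun n => by positivity)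
      fun n => ?_
    rw [← one_add_mul]
    refine mul_le_mul_of_nonneg_right ?_ (by positivity)
    -- The inequality `r² ≤ 1 + r⁴` lets the fourth-order weight control the second-order one.
    nlinarith [sq_nonneg (‖dualPoint a n‖ ^ 2 - 1)]
  refine ⟨hu, fun j => ?_⟩
  obtain ⟨g, hg, hg2⟩ := exists_hasWeakPartial hu hs1 j
  refine ⟨g, hg, memSobolev_one_iff.mpr ⟨hg2, ?_⟩⟩
  refine hs.of_nonneg_of_le (fun n => by positivity) fun n => ?_
  rw [hg.coeff_eq, norm_partial_symbol_sq, ← mul_assoc]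
  refine mul_le_mul_of_nonneg_right ?_ (by positivity)
  calc ‖dualPoint a n‖ ^ 2 * dualPoint a n j ^ 2
      ≤ ‖dualPoint a n‖ ^ 2 * ‖dualPoint a n‖ ^ 2 :=
        mul_le_mul_of_nonneg_left (dualPoint_apply_sq_le j n) (by positivity)
    _ = ‖dualPoint a n‖ ^ 4 := by ring

theorem weakLaplacian_coeff {u : Torus a → ℂ} (h : MemSobolev a 2 u) :
    Integrable (weakLaplacian a u) (cellMeasure a) ∧
      ∀ n, coeff (weakLaplacian a u) n = -((‖dualPoint a n‖ ^ 2 : ℝ) : ℂ) * coeff u n := by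
  have h1 : ∀ j, HasWeakPartial a j u (weakPartial a j u) := fun j => by
    obtain ⟨g, hg, -⟩ := h.2 j
    exact hg.weakPartial
  -- The second derivative is known to exist for the witness `g` only; it is carried over to the
  -- chosen derivative by almost everywhere equality.
  have h2 : ∀ j, HasWeakPartial a j (weakPartial a j u)
      (weakPartial a j (weakPartial a j u)) := fun j => by
    obtain ⟨g, hg, hg1⟩ := h.2 j
    obtain ⟨f, hf, -⟩ := hg1.2 j
    exact (hf.congr (hg.ae_unique (h1 j))).weakPartial
  refine ⟨integrable_finsetSum _ fun j _ => (h2 j).2.1, fun n => ?_⟩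
  rw [show weakLaplacian a u = fun x => ∑ j, weakPartial a j (weakPartial a j u) x from rfl,
    coeff_sum _ fun j _ => (h2 j).2.1, norm_dualPoint_sq]
  push_cast
  rw [← Finset.sum_neg_distrib, Finset.sum_mul]
  refine Finset.sum_congr rfl fun j _ => ?_
  rw [(h2 j).coeff_eq, (h1 j).coeff_eq]
  linear_combination (dualPoint a n j : ℂ) ^ 2 * coeff u n * Complex.I_sq

end Sobolev

/-! ### The Sobolev embedding `H¹ ⊂ L⁴` -/

section Embedding

open Filter Topology ComplexConjugate

variable {a : Module.Basis (Fin 3) ℝ Space}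

variable (a) in
theorem linearIndependent_dualVector : LinearIndependent ℝ (dualVector a) := by
  rw [Fintype.linearIndependent_iff]
  intro c hc j
  have h : ⟪∑ i, c i • dualVector a i, a j⟫_ℝ = 0 := by rw [hc, inner_zero_left]
  simpa [sum_inner, inner_smul_left, inner_dualVector, Real.pi_ne_zero] using h

variable (a) in
/-- The dual lattice vectors have summable inverse fourth powers. -/
theorem summable_inv_norm_dualPoint_pow_four :
    Summable fun n : Fin 3 → ℤ => (‖dualPoint a n‖ ^ 4)⁻¹ := by
  let b : Module.Basis (Fin 3) ℝ Space :=
    basisOfLinearIndependentOfCardEqFinrank (linearIndependent_dualVector a) (by simp)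
  let L : Submodule ℤ Space := Submodule.span ℤ (Set.range b)
  have hb : ∀ i, b i = dualVector a i := fun i => by simp [b]
  have hmem : ∀ n : Fin 3 → ℤ, dualPoint a n ∈ L := fun n => by
    refine Submodule.sum_mem _ fun i _ => ?_
    rw [Int.cast_smul_eq_zsmul, ← hb i]
    exact Submodule.smul_mem _ _ (Submodule.subset_span ⟨i, rfl⟩)
  have hrank : Module.finrank ℤ L = 3 := by
    rw [ZLattice.rank ℝ L]
    simp
  -- Dimension three enters here: the exponent `4` exceeds the rank `3`. The term at the origin is
  -- `0` by the convention for inverses.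
  have h := ZLattice.summable_norm_pow_inv L 4 (by omega)
  have h2 := h.comp_injective (i := fun n : Fin 3 → ℤ => (⟨dualPoint a n, hmem n⟩ : L))
    fun n l hnl => dualPoint_injective a (congr_arg Subtype.val hnl)
  simpa [Function.comp_def] using h2

variable (a) in
theorem summable_inv_one_add_norm_dualPoint_sq :
    Summable fun n : Fin 3 → ℤ => ((1 + ‖dualPoint a n‖ ^ 2) ^ 2)⁻¹ := by
  -- The comparison series vanishes at `n = 0`, where the left side equals `1`; this indicator makes
  -- up the difference.
  have h0 : Summable fun n : Fin 3 → ℤ => if n = 0 then (1 : ℝ) else 0 :=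
    (hasSum_ite_eq 0 1).summable
  refine ((summable_inv_norm_dualPoint_pow_four a).add h0).of_nonneg_of_le
    (fun n => by positivity) fun n => ?_
  split_ifs with hn
  · subst hn
    simp
  · rw [add_zero]
    have := norm_pos_iff.mpr (dualPoint_ne_zero a hn)
    gcongr
    nlinarith [sq_nonneg (‖dualPoint a n‖)]

theorem coeff_wave_mul (u : Torus a → ℂ) (n l : Fin 3 → ℤ) :
    coeff (fun x => wave a n x * u x) l = coeff u (l + n) := by
  simp only [coeff, wave_add, mul_assoc]

/-- Parseval for `ψ` and `wave a n * ψ`: multiplying by a wave shifts coefficients, so the density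
has the autocorrelation of `ψ̂` as coefficients. -/
theorem hasSum_coeff_norm_sq {ψ : Torus a → ℂ} (hψ : MemLp ψ 2 (cellMeasure a))
    (n : Fin 3 → ℤ) :
    HasSum (fun l => conj (coeff ψ l) * coeff ψ (l + n))
      (cellVolume a * coeff (fun x => ((‖ψ x‖ ^ 2 : ℝ) : ℂ)) n) := by
  have h := hasSum_conj_coeff_mul hψ (memLp_wave_mul hψ n)
  simp only [coeff_wave_mul] at h
  convert! h using 2
  rw [coeff]
  congr 1 with x
  rw [← conj_mul_self_eq]
  ring

/-- With `w = 1 + |k|²` and `G = w |ψ̂|²` summable, Cauchy-Schwarz bounds the squared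
autocorrelation at `n` by `∑ G(l) G(l+n)` times `∑ 1/(w(l) w(l+n))`. The second factor is at most `C
= ∑ w⁻²` for every `n`, and the first sums over `n` to `(∑ G)²`. -/
theorem summable_coeff_norm_sq {ψ : Torus a → ℂ} (h : MemSobolev a 1 ψ) :
    Summable fun n => ‖coeff (fun x => ((‖ψ x‖ ^ 2 : ℝ) : ℂ)) n‖ ^ 2 := by
  set w : (Fin 3 → ℤ) → ℝ := fun n => 1 + ‖dualPoint a n‖ ^ 2 with hw
  have hw0 : ∀ n, 0 < w n := fun n => by positivity
  set G : (Fin 3 → ℤ) → ℝ := fun n => w n * ‖coeff ψ n‖ ^ 2 with hG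
  have hG0 : ∀ n, 0 ≤ G n := fun n => mul_nonneg (hw0 n).le (by positivity)
  have hGs : Summable G := by
    have := (summable_norm_coeff_sq h.1).add (memSobolev_one_iff.mp h).2
    refine this.congr fun n => ?_
    simp only [hG, hw]
    ring
  have hWs : Summable fun n => (w n ^ 2)⁻¹ := summable_inv_one_add_norm_dualPoint_sq a
  set C : ℝ := ∑' n, (w n ^ 2)⁻¹
  -- The map `(n, l) ↦ (l, l + n)` is injective, so this is a subfamily of the summable product
  -- family.
  have hGG : Summable fun p : (Fin 3 → ℤ) × (Fin 3 → ℤ) => G p.2 * G (p.2 + p.1) := by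
    refine (hGs.mul_of_nonneg hGs hG0 hG0).comp_injective
      (i := fun p : (Fin 3 → ℤ) × (Fin 3 → ℤ) => (p.2, p.2 + p.1)) fun p q hpq => ?_
    obtain ⟨h1, h2⟩ := Prod.mk.inj hpq
    rw [h1] at h2
    exact Prod.ext (add_left_cancel h2) h1
  have hfin : ∀ (n : Fin 3 → ℤ) (s : Finset (Fin 3 → ℤ)),
      ‖∑ l ∈ s, conj (coeff ψ l) * coeff ψ (l + n)‖ ^ 2 ≤ (∑' l, G l * G (l + n)) * C := by
    intro n s
    -- The arithmetic-geometric mean inequality separates the two weights; each resulting sum is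
    -- part of `C`, the second after reindexing by the shift.
    have hC : ∑ l ∈ s, (w l * w (l + n))⁻¹ ≤ C := by
      have h1 : ∑ l ∈ s, (w l ^ 2)⁻¹ ≤ C := hWs.sum_le_tsum s fun l _ => by positivity
      have h2 : ∑ l ∈ s, (w (l + n) ^ 2)⁻¹ ≤ C := by
        have := hWs.sum_le_tsum (s.map (addRightEmbedding n)) fun l _ => by positivity
        rwa [Finset.sum_map] at this
      have h3 : ∑ l ∈ s, (w l * w (l + n))⁻¹
          ≤ ∑ l ∈ s, ((w l ^ 2)⁻¹ + (w (l + n) ^ 2)⁻¹) / 2 := by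
        refine Finset.sum_le_sum fun l _ => ?_
        rw [mul_inv, ← inv_pow, ← inv_pow]
        nlinarith [sq_nonneg ((w l)⁻¹ - (w (l + n))⁻¹)]
      rw [← Finset.sum_div, Finset.sum_add_distrib] at h3
      linarith
    calc ‖∑ l ∈ s, conj (coeff ψ l) * coeff ψ (l + n)‖ ^ 2
        ≤ (∑ l ∈ s, ‖coeff ψ l‖ * ‖coeff ψ (l + n)‖) ^ 2 := by
          gcongr
          refine (norm_sum_le _ _).trans_eq ?_
          simp
      _ ≤ (∑ l ∈ s, G l * G (l + n)) * ∑ l ∈ s, (w l * w (l + n))⁻¹ := by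
          refine Finset.sum_sq_le_sum_mul_sum_of_sq_le_mul s
            (fun l _ => mul_nonneg (hG0 _) (hG0 _))
            (fun l _ => (inv_pos.mpr (mul_pos (hw0 _) (hw0 _))).le) fun l _ => ?_
          have h1 := (hw0 l).ne'
          have h2 := (hw0 (l + n)).ne'
          refine le_of_eq ?_
          simp only [hG]
          field_simp
      _ ≤ (∑' l, G l * G (l + n)) * C := by
          refine mul_le_mul ?_ hC (Finset.sum_nonneg fun l _ =>
            (inv_pos.mpr (mul_pos (hw0 _) (hw0 _))).le)
            (tsum_nonneg fun l => mul_nonneg (hG0 _) (hG0 _))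
          exact (hGG.prod_factor n).sum_le_tsum s fun l _ => mul_nonneg (hG0 _) (hG0 _)
  have hlim : ∀ n, ‖(cellVolume a : ℂ) * coeff (fun x => ((‖ψ x‖ ^ 2 : ℝ) : ℂ)) n‖ ^ 2
      ≤ (∑' l, G l * G (l + n)) * C := fun n =>
    le_of_tendsto ((hasSum_coeff_norm_sq h.1 n).norm.pow 2) (Eventually.of_forall (hfin n))
  have hs := ((hGG.prod.mul_right C).of_nonneg_of_le (fun n => by positivity) hlim).mul_left
    ((cellVolume a ^ 2)⁻¹)
  refine hs.congr fun n => ?_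
  have hV := (cellVolume_pos a).ne'
  rw [norm_mul, mul_pow, Complex.norm_real, Real.norm_eq_abs, sq_abs]
  field_simp

/-- For `ψ ∈ H¹` the density `|ψ|²` is square integrable. -/
theorem memLp_norm_sq {ψ : Torus a → ℂ} (h : MemSobolev a 1 ψ) :
    MemLp (fun x => ‖ψ x‖ ^ 2) 2 (cellMeasure a) := by
  obtain ⟨v, hv, hvc⟩ := exists_memLp_coeff_eq (summable_coeff_norm_sq h)
  have hint : Integrable (fun x => ((‖ψ x‖ ^ 2 : ℝ) : ℂ)) (cellMeasure a) :=
    (h.1.integrable_norm_pow (by norm_num)).ofReal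
  have hae := ae_eq_of_coeff_eq (hv.integrable (by norm_num)) hint hvc
  have h2 := (hv.ae_eq hae).norm
  simpa using h2

end Embedding

/-! ### The potential and the Coulomb energy -/

section Potential

open Filter Topology ComplexConjugate

variable {a : Module.Basis (Fin 3) ℝ Space}

/-- The Fourier coefficients of a real function. -/
abbrev coeffR (f : Torus a → ℝ) (n : Fin 3 → ℤ) : ℂ := coeff (fun x => (f x : ℂ)) n

theorem summable_coeffR_sq {f : Torus a → ℝ} (hf : MemLp f 2 (cellMeasure a)) :
    Summable fun n => ‖coeffR f n‖ ^ 2 := summable_norm_coeff_sq hf.ofReal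

/-- Both `ρ̂` and `|k|⁻²` are in `ℓ²`, so their product is in `ℓ¹`. -/
theorem summable_potential_coeff {f : Torus a → ℝ} (hf : MemLp f 2 (cellMeasure a)) :
    Summable fun n => ‖coeffR f n / ((‖dualPoint a n‖ ^ 2 : ℝ) : ℂ)‖ := by
  refine ((summable_coeffR_sq hf).add (summable_inv_norm_dualPoint_pow_four a)).of_nonneg_of_le
    (fun n => norm_nonneg _) fun n => ?_
  rw [norm_div, Complex.norm_real, Real.norm_of_nonneg (by positivity), div_eq_mul_inv]
  have : (‖dualPoint a n‖ ^ 4)⁻¹ = ((‖dualPoint a n‖ ^ 2)⁻¹) ^ 2 := by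
    rw [inv_pow, ← pow_mul]
  rw [this]
  nlinarith [sq_nonneg (‖coeffR f n‖ - (‖dualPoint a n‖ ^ 2)⁻¹), sq_nonneg ‖coeffR f n‖,
    sq_nonneg ((‖dualPoint a n‖ ^ 2)⁻¹)]

/-- Division by zero gives `0`, so the sum over nonzero indices may be taken over all of them; the
zero mode drops out by itself. -/
theorem invNegLaplacian_eq (f : Torus a → ℝ) (x : Torus a) :
    invNegLaplacian a f x = ∑' n : Fin 3 → ℤ,
      (1 / (cellVolume a : ℂ)) * (coeffR f n / ((‖dualPoint a n‖ ^ 2 : ℝ) : ℂ))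
        * wave a (-n) x := by
  rw [invNegLaplacian, ← tsum_mul_left]
  have h0 := sqrt_cellVolume_ne_zero (a := a)
  have h1 : ∀ n : {n : Fin 3 → ℤ // n ≠ 0}, (1 / (Real.sqrt (cellVolume a) : ℂ)) *
      (fourierCoeff a f n.1 / ((‖dualPoint a n.1‖ ^ 2 : ℝ) : ℂ) * wave a (-n.1) x)
      = (1 / (cellVolume a : ℂ)) * (coeffR f n.1 / ((‖dualPoint a n.1‖ ^ 2 : ℝ) : ℂ))
        * wave a (-n.1) x := fun n => by
    rw [fourierCoeff, ← sqrt_cellVolume_mul_self]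
    rw [show ∫ x, wave a n.1 x * (f x : ℂ) ∂(cellMeasure a) = coeffR f n.1 from rfl]
    have hk : ((‖dualPoint a n.1‖ ^ 2 : ℝ) : ℂ) ≠ 0 := by
      have := norm_pos_iff.mpr (dualPoint_ne_zero a n.2)
      exact_mod_cast (by positivity : ‖dualPoint a n.1‖ ^ 2 ≠ 0)
    field_simp
  rw [tsum_congr h1]
  refine tsum_subtype_eq_of_support_subset (s := {n : Fin 3 → ℤ | n ≠ 0}) (f := fun n =>
    (1 / (cellVolume a : ℂ)) * (coeffR f n / ((‖dualPoint a n‖ ^ 2 : ℝ) : ℂ))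
        * wave a (-n) x) fun n hn => ?_
  rintro rfl
  simp at hn

theorem summable_potential {f : Torus a → ℝ} (hf : MemLp f 2 (cellMeasure a)) :
    Summable fun n => ‖(1 / (cellVolume a : ℂ))
      * (coeffR f n / ((‖dualPoint a n‖ ^ 2 : ℝ) : ℂ))‖ := by
  simp only [norm_mul]
  exact (summable_potential_coeff hf).mul_left _

theorem continuous_invNegLaplacian {f : Torus a → ℝ} (hf : MemLp f 2 (cellMeasure a)) :
    Continuous (invNegLaplacian a f) := by
  rw [funext (invNegLaplacian_eq f)]
  refine continuous_tsum (fun n => continuous_const.mul (continuous_wave a _))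
    (summable_potential hf) fun n x => ?_
  rw [norm_mul _ (wave a (-n) x), norm_wave, mul_one]

theorem coeff_invNegLaplacian {f : Torus a → ℝ} (hf : MemLp f 2 (cellMeasure a))
    (n : Fin 3 → ℤ) :
    coeff (invNegLaplacian a f) n = coeffR f n / ((‖dualPoint a n‖ ^ 2 : ℝ) : ℂ) := by
  have hV : (cellVolume a : ℂ) ≠ 0 := by exact_mod_cast (cellVolume_pos a).ne'
  have h := hasSum_integral_of_summable_integral_norm (μ := cellMeasure a)
    (F := fun (l : Fin 3 → ℤ) (x : Torus a) => wave a n x * ((1 / (cellVolume a : ℂ))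
      * (coeffR f l / ((‖dualPoint a l‖ ^ 2 : ℝ) : ℂ)) * wave a (-l) x))
    (fun l => integrable_of_continuous ((continuous_wave a n).mul
      (continuous_const.mul (continuous_wave a (-l))))) (by
      have := (summable_potential hf).mul_right (cellVolume a)
      refine this.congr fun l => ?_
      simp only [norm_mul _ (wave a (-l) _), norm_mul (wave a n _), norm_wave, mul_one, one_mul]
      rw [integral_const, smul_eq_mul, mul_comm]
      rfl)
  have h1 : ∀ l, ∫ x, wave a n x * ((1 / (cellVolume a : ℂ))
      * (coeffR f l / ((‖dualPoint a l‖ ^ 2 : ℝ) : ℂ)) * wave a (-l) x) ∂(cellMeasure a)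
      = if l = n then coeffR f n / ((‖dualPoint a n‖ ^ 2 : ℝ) : ℂ) else 0 := fun l => by
    have := coeff_const_mul ((1 / (cellVolume a : ℂ))
      * (coeffR f l / ((‖dualPoint a l‖ ^ 2 : ℝ) : ℂ))) (wave a (-l)) n
    rw [coeff_wave] at this
    refine this.trans ?_
    rcases eq_or_ne l n with rfl | hne
    · rw [if_pos rfl, if_pos rfl]
      field_simp
    · rw [if_neg hne, if_neg hne.symm, mul_zero]
  simp only [h1] at h
  have h2 := (hasSum_ite_eq n (coeffR f n / ((‖dualPoint a n‖ ^ 2 : ℝ) : ℂ))).unique h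
  rw [h2, coeff]
  congr 1 with x
  rw [invNegLaplacian_eq, tsum_mul_left]

/-- Conjugation sends the term at `n` to the term at `-n`, since `f` is real. -/
theorem conj_invNegLaplacian (f : Torus a → ℝ) (x : Torus a) :
    conj (invNegLaplacian a f x) = invNegLaplacian a f x := by
  rw [invNegLaplacian_eq, Complex.conj_tsum]
  rw [← (Equiv.neg (Fin 3 → ℤ)).tsum_eq]
  refine tsum_congr fun n => ?_
  simp only [Equiv.neg_apply, map_mul, map_div₀, Complex.conj_ofReal, map_one, coeffR,
    coeff_ofReal_neg, Complex.conj_conj, dualPoint_neg, norm_neg, neg_neg, wave_neg]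

theorem ofReal_re_invNegLaplacian (f : Torus a → ℝ) (x : Torus a) :
    ((invNegLaplacian a f x).re : ℂ) = invNegLaplacian a f x :=
  Complex.conj_eq_iff_re.mp (conj_invNegLaplacian f x)

/-- The Coulomb interaction `∫ ((-Δ)⁻¹ f) g dx` of two charge densities. -/
def coulomb (f g : Torus a → ℝ) : ℝ := ∫ x, (invNegLaplacian a f x).re * g x ∂(cellMeasure a)

theorem integrable_potential_mul {f g : Torus a → ℝ} (hf : MemLp f 2 (cellMeasure a))
    (hg : MemLp g 2 (cellMeasure a)) :
    Integrable (fun x => (invNegLaplacian a f x).re * g x) (cellMeasure a) := by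
  have hc : Continuous fun x => (invNegLaplacian a f x).re :=
    Complex.continuous_re.comp (continuous_invNegLaplacian hf)
  have : MemLp (fun x => (invNegLaplacian a f x).re) 2 (cellMeasure a) :=
    hc.memLp_of_hasCompactSupport (HasCompactSupport.of_compactSpace _)
  exact this.integrable_mul hg

theorem hasSum_coulomb {f g : Torus a → ℝ} (hf : MemLp f 2 (cellMeasure a))
    (hg : MemLp g 2 (cellMeasure a)) :
    HasSum (fun n => conj (coeffR f n) * coeffR g n / ((‖dualPoint a n‖ ^ 2 : ℝ) : ℂ))
      ((cellVolume a * coulomb f g : ℝ) : ℂ) := by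
  have h := hasSum_conj_coeff_mul
    (memLp_of_continuous (continuous_invNegLaplacian hf) 2) (hg.ofReal (K := ℂ))
  convert! h using 1
  · ext n
    rw [coeff_invNegLaplacian hf, map_div₀, Complex.conj_ofReal, div_mul_eq_mul_div]
    rfl
  · rw [Complex.ofReal_mul, coulomb, ← integral_complex_ofReal]
    congr 2 with x
    rw [conj_invNegLaplacian, Complex.ofReal_mul, ofReal_re_invNegLaplacian]
    rfl

theorem hasSum_coulomb_self {f : Torus a → ℝ} (hf : MemLp f 2 (cellMeasure a)) :
    HasSum (fun n => ‖coeffR f n‖ ^ 2 / ‖dualPoint a n‖ ^ 2) (cellVolume a * coulomb f f) := by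
  have h := hasSum_coulomb hf hf
  simp only [conj_mul_self_eq, ← Complex.ofReal_div] at h
  exact_mod_cast h

/-- The Fourier series of the form is Hermitian and its value is real. -/
theorem coulomb_comm {f g : Torus a → ℝ} (hf : MemLp f 2 (cellMeasure a))
    (hg : MemLp g 2 (cellMeasure a)) : coulomb f g = coulomb g f := by
  have h := hasSum_coulomb hf hg
  have h1 := (hasSum_coulomb hg hf).map (starRingEnd ℂ) Complex.continuous_conj
  have h2 : (starRingEnd ℂ ∘ fun n =>
      conj (coeffR g n) * coeffR f n / ((‖dualPoint a n‖ ^ 2 : ℝ) : ℂ))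
      = fun n => conj (coeffR f n) * coeffR g n / ((‖dualPoint a n‖ ^ 2 : ℝ) : ℂ) := by
    funext n
    simp only [Function.comp_apply, map_div₀, map_mul, Complex.conj_conj, Complex.conj_ofReal]
    ring
  rw [h2, Complex.conj_ofReal] at h1
  exact mul_left_cancel₀ (cellVolume_pos a).ne' (Complex.ofReal_injective (h.unique h1))

theorem coulomb_add_right {f g h : Torus a → ℝ} (hf : MemLp f 2 (cellMeasure a))
    (hg : MemLp g 2 (cellMeasure a)) (hh : MemLp h 2 (cellMeasure a)) :
    coulomb f (fun x => g x + h x) = coulomb f g + coulomb f h := by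
  simp only [coulomb, mul_add]
  exact integral_add (integrable_potential_mul hf hg) (integrable_potential_mul hf hh)

theorem coulomb_const_mul_right (f g : Torus a → ℝ) (c : ℝ) :
    coulomb f (fun x => c * g x) = c * coulomb f g := by
  simp only [coulomb, mul_left_comm _ c]
  exact integral_const_mul c _

theorem coulomb_add_left {f g h : Torus a → ℝ} (hf : MemLp f 2 (cellMeasure a))
    (hg : MemLp g 2 (cellMeasure a)) (hh : MemLp h 2 (cellMeasure a)) :
    coulomb (fun x => f x + g x) h = coulomb f h + coulomb g h := by
  rw [coulomb_comm (f := fun x => f x + g x) (hf.add hg) hh, coulomb_comm hf hh, coulomb_comm hg hh,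
    coulomb_add_right hh hf hg]

theorem coulomb_const_mul_left {f g : Torus a → ℝ} (hf : MemLp f 2 (cellMeasure a))
    (hg : MemLp g 2 (cellMeasure a)) (c : ℝ) :
    coulomb (fun x => c * f x) g = c * coulomb f g := by
  rw [coulomb_comm (f := fun x => c * f x) (hf.const_mul c) hg, coulomb_comm hf hg, coulomb_const_mul_right]

end Potential

/-! ### The energy -/

section Energy

variable {a : Module.Basis (Fin 3) ℝ Space} {N : ℕ}

variable (a) in
theorem measurePreserving_sub (y : Torus a) :
    MeasurePreserving (fun x => x - y) (cellMeasure a) (cellMeasure a) :=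
  measurePreserving_sub_right (cellMeasure a) y

theorem memLp_translate {f : Torus a → ℝ} {p : ENNReal} (hf : MemLp f p (cellMeasure a))
    (y : Torus a) : MemLp (fun x => f (x - y)) p (cellMeasure a) :=
  hf.comp_measurePreserving (measurePreserving_sub a y)

theorem coeffR_translate (f : Torus a → ℝ) (y : Torus a) (n : Fin 3 → ℤ) :
    coeffR (fun x => f (x - y)) n = wave a n y * coeffR f n := by
  have h := integral_sub_right_eq_self (μ := cellMeasure a)
    (fun x => wave a n (x + y) * (f x : ℂ)) y
  simp only [sub_add_cancel] at h
  rw [coeffR, coeff, h, coeffR, coeff, ← integral_const_mul]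
  congr 1 with x
  rw [wave_apply_add]
  ring

theorem memLp_ionDensity {ρper : Fin N → Torus a → ℝ} {p : ENNReal}
    (hρ : ∀ j, MemLp (ρper j) p (cellMeasure a)) (X : Fin N → Torus a) :
    MemLp (ionDensity ρper X) p (cellMeasure a) :=
  memLp_finsetSum _ fun j _ => memLp_translate (hρ j) (X j)

theorem memLp_chargeDensity {ρper : Fin N → Torus a → ℝ}
    (hρ : ∀ j, MemLp (ρper j) 2 (cellMeasure a)) {ψ : Torus a → ℂ} (hψ : MemSobolev a 1 ψ)
    (e : ℝ) (X : Fin N → Torus a) : MemLp (chargeDensity e ρper ψ X) 2 (cellMeasure a) :=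
  (memLp_ionDensity hρ X).sub ((memLp_norm_sq hψ).const_mul e)

theorem energy_eq {ρper : Fin N → Torus a → ℝ} (hρ : ∀ j, MemLp (ρper j) 2 (cellMeasure a))
    {ψ : Torus a → ℂ} (hψ : MemSobolev a 1 ψ) (ħ m e : ℝ) (X : Fin N → Torus a) :
    energy ħ m e ρper ψ X
      = ħ ^ 2 / (2 * m) * ∫ x, ∑ j, ‖weakPartial a j ψ x‖ ^ 2 ∂(cellMeasure a)
        + 1 / 2 * coulomb (chargeDensity e ρper ψ X) (chargeDensity e ρper ψ X) := by
  have hc := memLp_chargeDensity hρ hψ e X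
  have h1 : Integrable (fun x => ħ ^ 2 / (2 * m) * ∑ j, ‖weakPartial a j ψ x‖ ^ 2)
      (cellMeasure a) := Integrable.const_mul (integrable_finsetSum _ fun j _ =>
        (memSobolev_one_weakPartial hψ j).2.integrable_norm_pow (by norm_num)) _
  have h2 := (integrable_potential_mul hc hc).const_mul (1 / 2)
  simp only [energy, mul_assoc (1 / 2 : ℝ)]
  rw [integral_add h1 h2, integral_const_mul, integral_const_mul, coulomb]

/-- The energy in terms of Fourier coefficients. -/
theorem hasSum_energy {ρper : Fin N → Torus a → ℝ} (hρ : ∀ j, MemLp (ρper j) 2 (cellMeasure a))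
    {ψ : Torus a → ℂ} (hψ : MemSobolev a 1 ψ) (ħ m e : ℝ) (X : Fin N → Torus a) :
    HasSum (fun n => ħ ^ 2 / (2 * m) * (‖dualPoint a n‖ ^ 2 * ‖coeff ψ n‖ ^ 2)
        + 1 / 2 * (‖coeffR (chargeDensity e ρper ψ X) n‖ ^ 2 / ‖dualPoint a n‖ ^ 2))
      (cellVolume a * energy ħ m e ρper ψ X) := by
  have h := ((hasSum_gradient hψ).mul_left (ħ ^ 2 / (2 * m))).add
    ((hasSum_coulomb_self (memLp_chargeDensity hρ hψ e X)).mul_left (1 / 2))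
  rw [energy_eq hρ hψ]
  convert! h using 1
  ring

theorem coeffR_chargeDensity {ρper : Fin N → Torus a → ℝ}
    (hρ : ∀ j, MemLp (ρper j) 2 (cellMeasure a)) {ψ : Torus a → ℂ}
    (hψ : MemLp ψ 2 (cellMeasure a)) (e : ℝ) (X : Fin N → Torus a) (n : Fin 3 → ℤ) :
    coeffR (chargeDensity e ρper ψ X) n
      = ∑ j, wave a n (X j) * coeffR (ρper j) n - e * coeffR (fun x => ‖ψ x‖ ^ 2) n := by
  have h1 : ∀ j, Integrable (fun x => ((ρper j (x - X j) : ℝ) : ℂ)) (cellMeasure a) := fun j =>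
    ((memLp_translate (hρ j) (X j)).integrable (by norm_num)).ofReal
  have h2 : Integrable (fun x => ((‖ψ x‖ ^ 2 : ℝ) : ℂ)) (cellMeasure a) :=
    (hψ.integrable_norm_pow (by norm_num)).ofReal
  have h3 : (fun x => ((chargeDensity e ρper ψ X x : ℝ) : ℂ))
      = fun x => (∑ j, ((ρper j (x - X j) : ℝ) : ℂ)) - e * ((‖ψ x‖ ^ 2 : ℝ) : ℂ) := by
    funext x
    simp [chargeDensity, ionDensity]
  rw [coeffR, h3, coeff_sub (integrable_finsetSum _ fun j _ => h1 j) (h2.const_mul _),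
    coeff_const_mul, coeff_sum _ fun j _ => h1 j]
  simp only [← coeffR_translate]

end Energy

/-! ### Existence of a minimiser -/

section Existence

open Filter Topology ComplexConjugate

variable {a : Module.Basis (Fin 3) ℝ Space} {N : ℕ}

/-- Compactness in weighted `ℓ¹`: pointwise convergence to zero and a bound on a weighted sum with
weights tending to infinity imply convergence of the sums. -/
theorem tendsto_tsum_zero_of_weight {ι κ : Type*} {F : Filter κ} {w : ι → ℝ} {d : κ → ι → ℝ}
    {M : ℝ} (hw : Tendsto (fun n => (w n)⁻¹) cofinite (𝓝 0)) (hw0 : ∀ n, 0 < w n)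
    (hd0 : ∀ i n, 0 ≤ d i n) (hds : ∀ i, Summable (d i))
    (hwds : ∀ i, Summable fun n => w n * d i n) (hM : ∀ i, ∑' n, w n * d i n ≤ M)
    (hd : ∀ n, Tendsto (fun i => d i n) F (𝓝 0)) :
    Tendsto (fun i => ∑' n, d i n) F (𝓝 0) := by
  classical
  rw [Metric.tendsto_nhds]
  intro ε hε
  -- Outside the finite set where `w⁻¹ ≥ η` one has `d ≤ η w d`, so the tail costs at most `η M ≤ ε
  -- / 2`.
  set η : ℝ := ε / (2 * (|M| + 1)) with hη
  have hη0 : 0 < η := by positivity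
  have hS : {n | ¬ (w n)⁻¹ < η}.Finite := hw.eventually (gt_mem_nhds hη0)
  set S := hS.toFinset
  have hsum : Tendsto (fun i => ∑ n ∈ S, d i n) F (𝓝 0) := by
    simpa using tendsto_finsetSum S fun n _ => hd n
  filter_upwards [hsum.eventually (gt_mem_nhds (half_pos hε))] with i hi
  have h1 : ∀ n, d i n ≤ (if n ∈ S then d i n else 0) + η * (w n * d i n) := fun n => by
    split_ifs with hn
    · have := mul_nonneg hη0.le (mul_nonneg (hw0 n).le (hd0 i n))
      linarith
    · have hn' : (w n)⁻¹ < η := by simpa [S] using hn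
      have h2 : 1 ≤ η * w n := by
        have := mul_le_mul_of_nonneg_right hn'.le (hw0 n).le
        rwa [inv_mul_cancel₀ (hw0 n).ne'] at this
      have := mul_le_mul_of_nonneg_right h2 (hd0 i n)
      linarith
  have h2 : HasSum (fun n => if n ∈ S then d i n else 0) (∑ n ∈ S, d i n) := by
    have := hasSum_sum_of_ne_finset_zero (L := SummationFilter.unconditional ι) (s := S) (f := fun n => if n ∈ S then d i n else 0)
      fun n hn => by simp [hn]
    simpa [Finset.sum_ite_mem] using this
  have h3 := hasSum_le h1 (hds i).hasSum (h2.add ((hwds i).hasSum.mul_left η))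
  have h4 : η * ∑' n, w n * d i n ≤ ε / 2 := by
    calc η * ∑' n, w n * d i n ≤ η * (|M| + 1) := by
          gcongr
          linarith [hM i, le_abs_self M]
      _ = ε / 2 := by
          rw [hη]
          field_simp
  rw [Real.dist_eq, sub_zero, abs_of_nonneg (tsum_nonneg (hd0 i))]
  linarith

/-- Pointwise, with `p = |u - v|` and `q = |v|`, the difference of densities is at most `p (p +
2q)`; Young's inequality with parameter `η` splits the cross term. -/
theorem norm_coeff_norm_sq_sub_le {u v : Torus a → ℂ} (hu : MemLp u 2 (cellMeasure a))
    (hv : MemLp v 2 (cellMeasure a)) (n : Fin 3 → ℤ) {η : ℝ} (hη : 0 < η) :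
    ‖coeffR (fun x => ‖u x‖ ^ 2) n - coeffR (fun x => ‖v x‖ ^ 2) n‖
      ≤ (1 + η⁻¹) * ∫ x, ‖u x - v x‖ ^ 2 ∂(cellMeasure a)
        + η * ∫ x, ‖v x‖ ^ 2 ∂(cellMeasure a) := by
  have hiu := hu.integrable_norm_pow (p := 2) (by norm_num)
  have hiv := hv.integrable_norm_pow (p := 2) (by norm_num)
  have hid : Integrable (fun x => ‖u x - v x‖ ^ 2) (cellMeasure a) :=
    (hu.sub hv).integrable_norm_pow (by norm_num)
  have hcu : Integrable (fun x => ((‖u x‖ ^ 2 : ℝ) : ℂ)) (cellMeasure a) := hiu.ofReal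
  have hcv : Integrable (fun x => ((‖v x‖ ^ 2 : ℝ) : ℂ)) (cellMeasure a) := hiv.ofReal
  rw [coeffR, coeffR, ← coeff_sub hcu hcv]
  refine (norm_coeff_le _ _).trans ?_
  rw [← integral_const_mul, ← integral_const_mul,
    ← integral_add (hid.const_mul _) (hiv.const_mul _)]
  refine integral_mono (hcu.sub hcv).norm
    ((hid.const_mul _).add (hiv.const_mul _)) fun x => ?_
  have h1 : ‖((‖u x‖ ^ 2 : ℝ) : ℂ) - ((‖v x‖ ^ 2 : ℝ) : ℂ)‖
      = |‖u x‖ - ‖v x‖| * (‖u x‖ + ‖v x‖) := by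
    rw [← Complex.ofReal_sub, Complex.norm_real, Real.norm_eq_abs, sq_sub_sq, mul_comm, abs_mul,
      abs_of_nonneg (add_nonneg (norm_nonneg (u x)) (norm_nonneg (v x)))]
  have h2 := abs_norm_sub_norm_le (u x) (v x)
  have h3 : ‖u x‖ ≤ ‖u x - v x‖ + ‖v x‖ := by
    simpa using norm_add_le (u x - v x) (v x)
  simp only [h1]
  set p := ‖u x - v x‖
  set q := ‖v x‖
  have hp : 0 ≤ p := norm_nonneg _
  have hq : 0 ≤ q := norm_nonneg _
  calc |‖u x‖ - q| * (‖u x‖ + q) ≤ p * (p + q + q) := by gcongr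
    _ ≤ (1 + η⁻¹) * p ^ 2 + η * q ^ 2 := by
      have h4 : 0 ≤ η⁻¹ * (p - η * q) ^ 2 := by positivity
      have h5 : η⁻¹ * (p - η * q) ^ 2 = η⁻¹ * p ^ 2 - 2 * p * q + η * q ^ 2 := by
        field_simp
        ring
      linarith

/-- Strong `L²` convergence gives convergence of the Fourier coefficients of the densities. -/
theorem tendsto_coeff_norm_sq {κ : Type*} {F : Filter κ} {u : κ → Torus a → ℂ} {v : Torus a → ℂ}
    (hu : ∀ i, MemLp (u i) 2 (cellMeasure a)) (hv : MemLp v 2 (cellMeasure a))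
    (h : Tendsto (fun i => ∫ x, ‖u i x - v x‖ ^ 2 ∂(cellMeasure a)) F (𝓝 0))
    (n : Fin 3 → ℤ) :
    Tendsto (fun i => coeffR (fun x => ‖u i x‖ ^ 2) n) F (𝓝 (coeffR (fun x => ‖v x‖ ^ 2) n)) := by
  rw [Metric.tendsto_nhds]
  intro ε hε
  set K : ℝ := ∫ x, ‖v x‖ ^ 2 ∂(cellMeasure a)
  have hK : 0 ≤ K := integral_nonneg fun x => by positivity
  set η : ℝ := ε / (2 * (K + 1)) with hη
  have hη0 : 0 < η := by positivity
  have h1 := (h.const_mul (1 + η⁻¹)).eventually 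
    (gt_mem_nhds (show (1 + η⁻¹) * 0 < ε / 2 by simpa using hε))
  filter_upwards [h1] with i hi
  rw [dist_eq_norm]
  refine (norm_coeff_norm_sq_sub_le (hu i) hv n hη0).trans_lt ?_
  have h2 : η * K ≤ ε / 2 := by
    calc η * K ≤ η * (K + 1) := by gcongr; linarith
      _ = ε / 2 := by
        rw [hη]
        field_simp
  linarith

variable (a) in
theorem tendsto_inv_weight :
    Tendsto (fun n : Fin 3 → ℤ => (1 + ‖dualPoint a n‖ ^ 2)⁻¹) cofinite (𝓝 0) := by
  have h := (summable_inv_one_add_norm_dualPoint_sq a).tendsto_cofinite_zero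
  have h2 := (Real.continuous_sqrt.tendsto 0).comp h
  rw [Real.sqrt_zero] at h2
  refine h2.congr fun n => ?_
  rw [Function.comp_apply, ← inv_pow, Real.sqrt_sq (by positivity)]

theorem configurations_nonempty (a : Module.Basis (Fin 3) ℝ Space) (N : ℕ) {Z : ℝ}
    (hZ : 0 < Z) : (configurations a N Z).Nonempty := by
  have hV := cellVolume_pos a
  -- The witness is the constant function of mass `Z`, written with `wave a (-0)` so that
  -- `coeff_wave` applies.
  set c : ℂ := (Real.sqrt (Z / cellVolume a) : ℂ)
  refine ⟨(fun x => c * wave a (-0) x, fun _ => 0), ?_, ?_⟩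
  · refine memSobolev_one_iff.mpr ⟨(memLp_wave a _ 2).const_mul c, ?_⟩
    refine summable_of_ne_finset_zero (s := {0}) fun n hn => ?_
    rw [coeff_const_mul, coeff_wave, if_neg (by simpa using hn)]
    simp
  · simp only [norm_mul, norm_wave, mul_one]
    rw [integral_const, smul_eq_mul]
    change cellVolume a * _ = _
    rw [Complex.norm_real, Real.norm_eq_abs, sq_abs, Real.sq_sqrt (by positivity)]
    field_simp

theorem energy_nonneg {ρper : Fin N → Torus a → ℝ} (hρ : ∀ j, MemLp (ρper j) 2 (cellMeasure a))
    {ψ : Torus a → ℂ} (hψ : MemSobolev a 1 ψ) (ħ e : ℝ) {m : ℝ} (hm : 0 < m)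
    (X : Fin N → Torus a) : 0 ≤ energy ħ m e ρper ψ X :=
  nonneg_of_mul_nonneg_right ((hasSum_energy hρ hψ ħ m e X).nonneg fun n => by positivity)
    (cellVolume_pos a)

/-- The direct method: along a sequence of configurations with convergent energies there is a
limiting configuration whose energy is not larger than the limit. -/
theorem exists_energy_le_of_tendsto {ħ m e Z I : ℝ} (hħ : 0 < ħ) (hm : 0 < m)
    {ρper : Fin N → Torus a → ℝ} (hρ : ∀ j, MemLp (ρper j) 2 (cellMeasure a))
    {p : ℕ → (Torus a → ℂ) × (Fin N → Torus a)} (hp : ∀ i, p i ∈ configurations a N Z)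
    (hI : Tendsto (fun i => energy ħ m e ρper (p i).1 (p i).2) atTop (𝓝 I)) :
    ∃ q ∈ configurations a N Z, energy ħ m e ρper q.1 q.2 ≤ I := by
  have hV := cellVolume_pos a
  have hA : 0 < ħ ^ 2 / (2 * m) := by positivity
  obtain ⟨C, hC⟩ := hI.bddAbove_range
  have hCi : ∀ i, energy ħ m e ρper (p i).1 (p i).2 ≤ C := fun i => hC ⟨i, rfl⟩
  have hH1 : ∀ i, MemSobolev a 1 (p i).1 := fun i => (hp i).1
  set c : ℕ → (Fin 3 → ℤ) → ℂ := fun i => coeff (p i).1 with hc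
  set K : ℝ := cellVolume a * C / (ħ ^ 2 / (2 * m)) with hK
  have hcs : ∀ i, HasSum (fun n => ‖c i n‖ ^ 2) (cellVolume a * Z) := fun i => by
    have := hasSum_norm_coeff_sq (hH1 i).1
    rwa [(hp i).2] at this
  have hgs : ∀ i, Summable fun n => ‖dualPoint a n‖ ^ 2 * ‖c i n‖ ^ 2 := fun i =>
    (hasSum_gradient (hH1 i)).summable
  -- The Coulomb terms are nonnegative, so the energy bound alone bounds the gradients.
  have hgK : ∀ i, ∑' n, ‖dualPoint a n‖ ^ 2 * ‖c i n‖ ^ 2 ≤ K := fun i => by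
    have h1 := hasSum_energy hρ (hH1 i) ħ m e (p i).2
    have h2 := hasSum_le (fun n => le_add_of_nonneg_right (by positivity))
      ((hgs i).hasSum.mul_left (ħ ^ 2 / (2 * m))) h1
    rw [hK, le_div_iff₀ hA, mul_comm]
    exact h2.trans (mul_le_mul_of_nonneg_left (hCi i) hV.le)
  -- Along an ultrafilter all coefficients and all ion positions converge at once, which replaces a
  -- diagonal extraction of subsequences.
  set F : Ultrafilter ℕ := Ultrafilter.of atTop
  have hF : (F : Filter ℕ) ≤ atTop := Ultrafilter.of_le _
  have hlimc : ∀ n, ∃ z : ℂ, Tendsto (fun i => c i n) F (𝓝 z) := fun n => by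
    have hb : ∀ i, c i n ∈ Metric.closedBall (0 : ℂ) (Real.sqrt (cellVolume a * Z)) := fun i => by
      rw [mem_closedBall_zero_iff]
      refine Real.le_sqrt_of_sq_le ?_
      exact le_hasSum (hcs i) n fun l _ => by positivity
    obtain ⟨z, -, hz⟩ := (isCompact_closedBall (0 : ℂ) _).ultrafilter_le_nhds'
      (F.map fun i => c i n) (Ultrafilter.mem_map.mpr (Filter.univ_mem' hb))
    exact ⟨z, hz⟩
  choose z hz using hlimc
  obtain ⟨X, -, hX⟩ := (isCompact_univ (X := Fin N → Torus a)).ultrafilter_le_nhds'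
    (F.map fun i => (p i).2) Filter.univ_mem
  have hX' : Tendsto (fun i => (p i).2) F (𝓝 X) := hX
  have hzs : Summable fun n => ‖z n‖ ^ 2 := by
    refine summable_of_sum_le (c := cellVolume a * Z) (fun n => by positivity) fun s => ?_
    exact le_of_tendsto (tendsto_finsetSum s fun n _ => (hz n).norm.pow 2)
      (Eventually.of_forall fun i => sum_le_hasSum s (fun n _ => by positivity) (hcs i))
  have hzgK : ∀ s : Finset (Fin 3 → ℤ), ∑ n ∈ s, ‖dualPoint a n‖ ^ 2 * ‖z n‖ ^ 2 ≤ K := fun s =>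
    le_of_tendsto (tendsto_finsetSum s fun n _ => ((hz n).norm.pow 2).const_mul _)
      (Eventually.of_forall fun i =>
        ((hgs i).sum_le_tsum s fun n _ => by positivity).trans (hgK i))
  have hzg : Summable fun n => ‖dualPoint a n‖ ^ 2 * ‖z n‖ ^ 2 :=
    summable_of_sum_le (fun n => by positivity) hzgK
  obtain ⟨ψ, hψ, hψz⟩ := exists_memLp_coeff_eq hzs
  have hψ1 : MemSobolev a 1 ψ := memSobolev_one_iff.mpr ⟨hψ, by simpa only [hψz] using hzg⟩
  have hdsum : ∀ i, HasSum (fun n => ‖c i n - z n‖ ^ 2)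
      (cellVolume a * ∫ x, ‖(p i).1 x - ψ x‖ ^ 2 ∂(cellMeasure a)) := fun i => by
    have := hasSum_norm_coeff_sq (u := fun x => (p i).1 x - ψ x) ((hH1 i).1.sub hψ)
    simpa only [coeff_sub ((hH1 i).1.integrable (by norm_num)) (hψ.integrable (by norm_num)),
      hψz] using this
  have hnorm : ∀ x y : ℂ, ‖x - y‖ ^ 2 ≤ 2 * (‖x‖ ^ 2 + ‖y‖ ^ 2) := fun x y => by
    have h1 := norm_sub_le x y
    nlinarith [sq_nonneg (‖x‖ - ‖y‖), norm_nonneg (x - y), norm_nonneg x, norm_nonneg y]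
  have hwle : ∀ i n, (1 + ‖dualPoint a n‖ ^ 2) * ‖c i n - z n‖ ^ 2
      ≤ 2 * ((‖c i n‖ ^ 2 + ‖z n‖ ^ 2)
        + (‖dualPoint a n‖ ^ 2 * ‖c i n‖ ^ 2 + ‖dualPoint a n‖ ^ 2 * ‖z n‖ ^ 2)) :=
    fun i n => by
      refine (mul_le_mul_of_nonneg_left (hnorm (c i n) (z n)) (by positivity)).trans_eq ?_
      ring
  have hwhas : ∀ i, HasSum (fun n => 2 * ((‖c i n‖ ^ 2 + ‖z n‖ ^ 2)
        + (‖dualPoint a n‖ ^ 2 * ‖c i n‖ ^ 2 + ‖dualPoint a n‖ ^ 2 * ‖z n‖ ^ 2)))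
      (2 * ((cellVolume a * Z + ∑' n, ‖z n‖ ^ 2)
        + ((∑' n, ‖dualPoint a n‖ ^ 2 * ‖c i n‖ ^ 2)
          + ∑' n, ‖dualPoint a n‖ ^ 2 * ‖z n‖ ^ 2))) := fun i =>
    (((hcs i).add hzs.hasSum).add ((hgs i).hasSum.add hzg.hasSum)).mul_left 2
  have hws : ∀ i, Summable fun n => (1 + ‖dualPoint a n‖ ^ 2) * ‖c i n - z n‖ ^ 2 := fun i =>
    (hwhas i).summable.of_nonneg_of_le (fun n => by positivity) (hwle i)
  -- Rellich's theorem: the uniform `H¹` bound prevents mass from escaping to high frequencies.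
  have hd0 : Tendsto (fun i => ∑' n, ‖c i n - z n‖ ^ 2) F (𝓝 0) := by
    refine tendsto_tsum_zero_of_weight (w := fun n => 1 + ‖dualPoint a n‖ ^ 2)
      (M := 2 * ((cellVolume a * Z + ∑' n, ‖z n‖ ^ 2)
        + (K + ∑' n, ‖dualPoint a n‖ ^ 2 * ‖z n‖ ^ 2)))
      (tendsto_inv_weight a) (fun n => by positivity) (fun i n => by positivity)
      (fun i => (hdsum i).summable) hws (fun i => ?_) fun n => ?_
    · refine (hasSum_le (hwle i) (hws i).hasSum (hwhas i)).trans ?_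
      linarith [hgK i]
    · have := ((hz n).sub_const (z n)).norm.pow 2
      simpa using this
  have hstrong : Tendsto (fun i => ∫ x, ‖(p i).1 x - ψ x‖ ^ 2 ∂(cellMeasure a)) F (𝓝 0) := by
    have h1 := hd0.const_mul (cellVolume a)⁻¹
    rw [mul_zero] at h1
    refine h1.congr fun i => ?_
    rw [(hdsum i).tsum_eq, inv_mul_cancel_left₀ hV.ne']
  have hsq := tendsto_coeff_norm_sq (fun i => (hH1 i).1) hψ hstrong
  have hZ0 : ∀ u : Torus a → ℂ, coeffR (fun x => ‖u x‖ ^ 2) 0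
      = ((∫ x, ‖u x‖ ^ 2 ∂(cellMeasure a) : ℝ) : ℂ) := fun u => by
    rw [coeffR, coeff, ← integral_complex_ofReal]
    simp
  -- The mass is the zeroth coefficient of the density, so it passes to the limit.
  have hnormψ : ∫ x, ‖ψ x‖ ^ 2 ∂(cellMeasure a) = Z := by
    have h1 := hsq 0
    simp only [hZ0, fun i => (hp i).2] at h1
    exact_mod_cast (tendsto_nhds_unique h1 tendsto_const_nhds)
  have hρlim : ∀ n, Tendsto (fun i => coeffR (chargeDensity e ρper (p i).1 (p i).2) n) F
      (𝓝 (coeffR (chargeDensity e ρper ψ X) n)) := fun n => by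
    simp only [coeffR_chargeDensity hρ hψ, fun i => coeffR_chargeDensity hρ (hH1 i).1]
    refine (tendsto_finsetSum _ fun j _ => ?_).sub ((hsq n).const_mul _)
    exact (((continuous_wave a n).tendsto _).comp ((tendsto_pi_nhds.mp hX') j)).mul_const _
  refine ⟨(ψ, X), ⟨hψ1, hnormψ⟩, ?_⟩
  have h1 := hasSum_energy hρ hψ1 ħ m e X
  -- Fatou for series: each finite partial sum converges along the ultrafilter and stays below the
  -- full energies.
  refine le_of_mul_le_mul_left (hasSum_le_of_sum_le h1 fun s => ?_) hV
  refine le_of_tendsto_of_tendsto (tendsto_finsetSum s fun n _ => ?_)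
    ((hI.mono_left hF).const_mul (cellVolume a))
    (Eventually.of_forall fun i =>
      sum_le_hasSum s (fun n _ => by positivity) (hasSum_energy hρ (hH1 i) ħ m e (p i).2))
  rw [hψz]
  exact ((((hz n).norm.pow 2).const_mul _).const_mul _).add
    ((((hρlim n).norm.pow 2).div_const _).const_mul _)

theorem exists_isMinimiser {ħ m e : ℝ} (hħ : 0 < ħ) (hm : 0 < m)
    {ρper : Fin N → Torus a → ℝ} (hρ : ∀ j, MemLp (ρper j) 2 (cellMeasure a))
    (hZ : 0 < totalZ e ρper) :
    ∃ (ψ₀ : Torus a → ℂ) (X₀ : Fin N → Torus a), IsMinimiser ħ m e ρper ψ₀ X₀ := by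
  set S : Set ℝ := (fun p : (Torus a → ℂ) × (Fin N → Torus a) => energy ħ m e ρper p.1 p.2) ''
    configurations a N (totalZ e ρper) with hS
  have hne : S.Nonempty := (configurations_nonempty a N hZ).image _
  have hbdd : BddBelow S := by
    refine ⟨0, ?_⟩
    rintro _ ⟨p, hp, rfl⟩
    exact energy_nonneg hρ hp.1 ħ e hm p.2
  obtain ⟨u, -, hu, huS⟩ := exists_seq_tendsto_sInf hne hbdd
  choose p hp hpu using huS
  have hlim : Tendsto (fun i => energy ħ m e ρper (p i).1 (p i).2) atTop (𝓝 (sInf S)) := by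
    simpa only [hpu] using hu
  obtain ⟨q, hq, hqe⟩ := exists_energy_le_of_tendsto hħ hm hρ hp hlim
  exact ⟨q.1, q.2, hq, fun r hr => hqe.trans (csInf_le hbdd ⟨r, hr, rfl⟩)⟩

end Existence

/-! ### The stationary Newton equations -/

section Newton

open Filter Topology ComplexConjugate

variable {a : Module.Basis (Fin 3) ℝ Space} {N : ℕ}

theorem memSobolev_two_potential {f : Torus a → ℝ} (hf : MemLp f 2 (cellMeasure a)) :
    MemSobolev a 2 (invNegLaplacian a f) := by
  refine memSobolev_two_of_summable (memLp_of_continuous (continuous_invNegLaplacian hf) 2) ?_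
  refine (summable_coeffR_sq hf).of_nonneg_of_le (fun n => by positivity) fun n => ?_
  rw [coeff_invNegLaplacian hf, norm_div, Complex.norm_real, Real.norm_of_nonneg (by positivity),
    div_pow, ← pow_mul]
  rcases eq_or_ne (‖dualPoint a n‖) 0 with h | h
  · rw [h]
    simp only [ne_eq, OfNat.ofNat_ne_zero, not_false_eq_true, zero_pow, zero_mul]
    positivity
  · rw [mul_div_cancel₀ _ (pow_ne_zero _ h)]

/-- The potential has no zero mode, so the equation at `n = 0` is precisely the vanishing mean of
`f`. -/
theorem poissonEq_potential {f : Torus a → ℝ} (hf : MemLp f 2 (cellMeasure a))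
    (h0 : ∫ x, f x ∂(cellMeasure a) = 0) :
    PoissonEq (fun x => (invNegLaplacian a f x).re) f := by
  simp only [PoissonEq, ofReal_re_invNegLaplacian]
  obtain ⟨hint, hc⟩ := weakLaplacian_coeff (memSobolev_two_potential hf)
  have hfi : Integrable (fun x => (f x : ℂ)) (cellMeasure a) :=
    (hf.integrable (by norm_num)).ofReal
  refine ae_eq_of_coeff_eq hint.neg hfi fun n => ?_
  have h1 := coeff_const_mul (-1) (weakLaplacian a (invNegLaplacian a f)) n
  simp only [neg_one_mul] at h1
  refine h1.trans ?_
  rw [hc, coeff_invNegLaplacian hf, neg_mul, neg_neg]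
  rcases eq_or_ne n 0 with rfl | hn
  · have : coeffR f 0 = 0 := by
      rw [coeffR, coeff]
      simp only [wave_zero, one_mul]
      rw [integral_complex_ofReal, h0, Complex.ofReal_zero]
    rw [this, zero_div, mul_zero]
    exact this.symm
  · have := norm_pos_iff.mpr (dualPoint_ne_zero a hn)
    rw [mul_div_cancel₀]
    exact_mod_cast (by positivity : ‖dualPoint a n‖ ^ 2 ≠ 0)

variable (a) in
-- Each term of a convergent nonnegative series is at most its sum, and `r ≤ 1 + r⁴`.
theorem exists_inv_norm_dualPoint_le : ∃ C : ℝ, ∀ n : Fin 3 → ℤ, ‖dualPoint a n‖⁻¹ ≤ C := by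
  refine ⟨1 + ∑' n : Fin 3 → ℤ, (‖dualPoint a n‖ ^ 4)⁻¹, fun n => ?_⟩
  have h1 := (summable_inv_norm_dualPoint_pow_four a).le_tsum n fun l _ => by positivity
  rw [← inv_pow] at h1
  set r := ‖dualPoint a n‖⁻¹
  nlinarith [sq_nonneg (r ^ 2 - 1), sq_nonneg (r - 1), sq_nonneg r]

theorem abs_dualPoint_div_le (i : Fin 3) (n : Fin 3 → ℤ) :
    |dualPoint a n i| / ‖dualPoint a n‖ ^ 2 ≤ ‖dualPoint a n‖⁻¹ := by
  have h1 : |dualPoint a n i| ≤ ‖dualPoint a n‖ :=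
    abs_le_of_sq_le_sq (dualPoint_apply_sq_le i n) (norm_nonneg _)
  rcases eq_or_ne (‖dualPoint a n‖) 0 with h | h
  · rw [h]
    simp
  · rw [div_le_iff₀ (by positivity), pow_two, inv_mul_cancel_left₀ h]
    exact h1

/-- The terms of the Fourier series of the force `∫ ∂ᵢ((-Δ)⁻¹ f) g dx`. -/
def forceTerm (i : Fin 3) (f g : Torus a → ℝ) (n : Fin 3 → ℤ) : ℂ :=
  Complex.I * dualPoint a n i * (conj (coeffR f n) * coeffR g n / ((‖dualPoint a n‖ ^ 2 : ℝ) : ℂ))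

theorem summable_norm_forceTerm (i : Fin 3) {f g : Torus a → ℝ}
    (hf : MemLp f 2 (cellMeasure a)) (hg : MemLp g 2 (cellMeasure a)) :
    Summable fun n => ‖forceTerm i f g n‖ := by
  obtain ⟨C, hC⟩ := exists_inv_norm_dualPoint_le a
  refine (((summable_coeffR_sq hf).add (summable_coeffR_sq hg)).mul_left C).of_nonneg_of_le
    (fun n => norm_nonneg _) fun n => ?_
  have h1 : ‖forceTerm i f g n‖
      = |dualPoint a n i| / ‖dualPoint a n‖ ^ 2 * (‖coeffR f n‖ * ‖coeffR g n‖) := by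
    simp only [forceTerm, norm_mul, norm_div, Complex.norm_I, one_mul, Complex.norm_real,
      Real.norm_eq_abs, RCLike.norm_conj, abs_pow, abs_norm]
    ring
  rw [h1]
  refine mul_le_mul ((abs_dualPoint_div_le i n).trans (hC n)) ?_ (by positivity)
    ((inv_nonneg.mpr (norm_nonneg _)).trans (hC 0))
  nlinarith [sq_nonneg (‖coeffR f n‖ - ‖coeffR g n‖), sq_nonneg (‖coeffR f n‖),
    sq_nonneg (‖coeffR g n‖)]

/-- Translating `g` multiplies its coefficients by unimodular phases, so the series is
differentiated termwise. The factor `|k| / |k|²` keeps the derivatives summable, and no smoothness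
of `g` is needed. -/
theorem hasDerivAt_coulomb_translate (i : Fin 3) {f g : Torus a → ℝ}
    (hf : MemLp f 2 (cellMeasure a)) (hg : MemLp g 2 (cellMeasure a)) :
    HasDerivAt (fun t : ℝ => cellVolume a * coulomb f
      (fun x => g (x - proj a (t • EuclideanSpace.single i (1 : ℝ)))))
      (∑' n, forceTerm i f g n).re 0 := by
  set v : Space := EuclideanSpace.single i (1 : ℝ) with hv
  set q : (Fin 3 → ℤ) → ℂ := fun n =>
    conj (coeffR f n) * coeffR g n / ((‖dualPoint a n‖ ^ 2 : ℝ) : ℂ) with hq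
  have hsum : ∀ t : ℝ, HasSum (fun n => q n * wave a n (0 + proj a (t • v)))
      ((cellVolume a * coulomb f (fun x => g (x - proj a (t • v))) : ℝ) : ℂ) := fun t => by
    have h := hasSum_coulomb hf (memLp_translate hg (proj a (t • v)))
    refine h.congr_fun fun n => ?_
    rw [coeffR_translate, zero_add]
    simp only [hq]
    ring
  have hd := hasDerivAt_tsum (𝕜 := ℝ) (y₀ := 0)
    (g := fun n (t : ℝ) => q n * wave a n (0 + proj a (t • v)))
    (g' := fun n (t : ℝ) => q n *
      (Complex.I * dualPoint a n i * wave a n (0 + proj a (t • v))))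
    (summable_norm_forceTerm i hf hg)
    (fun n t => (hasDerivAt_wave i n 0 t).const_mul (q n))
    (fun n t => by
      rw [norm_mul, norm_mul _ (wave a n _), norm_wave, mul_one, mul_comm, ← norm_mul]
      rfl)
    (hsum 0).summable 0
  have h1 : (fun t : ℝ => ∑' n, q n * wave a n (0 + proj a (t • v)))
      = fun t => ((cellVolume a * coulomb f (fun x => g (x - proj a (t • v))) : ℝ) : ℂ) :=
    funext fun t => (hsum t).tsum_eq
  rw [h1] at hd
  have h2 : ∑' n, q n * (Complex.I * dualPoint a n i * wave a n (0 + proj a ((0 : ℝ) • v)))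
      = ∑' n, forceTerm i f g n := tsum_congr fun n => by
    rw [zero_smul, proj_zero, add_zero, wave_apply_zero, mul_one, mul_comm]
    rfl
  rw [h2] at hd
  set Φ : ℝ → ℂ := fun t =>
    ((cellVolume a * coulomb f (fun x => g (x - proj a (t • v))) : ℝ) : ℂ)
  exact (Complex.reCLM.hasFDerivAt (x := Φ 0)).comp_hasDerivAt (0 : ℝ) (f := Φ) hd

theorem hasSum_force (i : Fin 3) {f g : Torus a → ℝ}
    (hf : MemLp f 2 (cellMeasure a)) (hg : MemLp g 2 (cellMeasure a)) :
    HasSum (forceTerm i f g)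
      (cellVolume a * ∫ x, weakPartial a i (invNegLaplacian a f) x * (g x : ℂ)
        ∂(cellMeasure a)) := by
  have hs := memSobolev_two_potential hf
  have hs1 : MemSobolev a 1 (invNegLaplacian a f) :=
    ⟨hs.1, fun j => by
      obtain ⟨h, hh, h1⟩ := hs.2 j
      exact ⟨h, hh, h1.1⟩⟩
  obtain ⟨hp, hp2⟩ := memSobolev_one_weakPartial hs1 i
  refine (hasSum_coeff_neg_mul hp2 (hg.ofReal (K := ℂ))).congr_fun fun n => ?_
  rw [hp.coeff_eq, coeff_invNegLaplacian hf, dualPoint_neg, norm_neg, coeffR, coeff_ofReal_neg,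
    forceTerm]
  simp only [PiLp.neg_apply, Complex.ofReal_neg]
  change _ = _ * coeffR g n
  ring

theorem forceTerm_neg (i : Fin 3) (f g : Torus a → ℝ) (n : Fin 3 → ℤ) :
    forceTerm i f g (-n) = conj (forceTerm i f g n) := by
  simp only [forceTerm, coeffR, coeff_ofReal_neg, dualPoint_neg, norm_neg, map_mul, map_div₀,
    Complex.conj_conj, Complex.conj_ofReal, Complex.conj_I, PiLp.neg_apply, Complex.ofReal_neg]
  ring

theorem tsum_forceTerm_im (i : Fin 3) (f g : Torus a → ℝ) :
    (∑' n, forceTerm i f g n).im = 0 := by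
  rw [← Complex.conj_eq_iff_im, Complex.conj_tsum, ← (Equiv.neg (Fin 3 → ℤ)).tsum_eq]
  refine tsum_congr fun n => ?_
  rw [Equiv.neg_apply, forceTerm_neg, Complex.conj_conj]

/-- A charge exerts no force on itself: its own term is `i kᵢ |ĝ|² / |k|²`, which is purely
imaginary. -/
theorem forceTerm_add_self_re (i : Fin 3) {f g : Torus a → ℝ}
    (hf : MemLp f 2 (cellMeasure a)) (hg : MemLp g 2 (cellMeasure a)) (n : Fin 3 → ℤ) :
    (forceTerm i (fun x => f x + g x) g n).re = (forceTerm i f g n).re := by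
  have hfi : Integrable (fun x => (f x : ℂ)) (cellMeasure a) :=
    (hf.integrable (by norm_num)).ofReal
  have hgi : Integrable (fun x => (g x : ℂ)) (cellMeasure a) :=
    (hg.integrable (by norm_num)).ofReal
  have h1 : coeffR (fun x => f x + g x) n = coeffR f n + coeffR g n := by
    simp only [coeffR, Complex.ofReal_add]
    exact coeff_add hfi hgi n
  have h2 : forceTerm i (fun x => f x + g x) g n = forceTerm i f g n
      + ((dualPoint a n i * ‖coeffR g n‖ ^ 2 / ‖dualPoint a n‖ ^ 2 : ℝ) : ℂ) * Complex.I := by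
    simp only [forceTerm, h1, map_add, add_mul, conj_mul_self_eq]
    push_cast
    ring
  rw [h2, Complex.add_re, Complex.re_ofReal_mul, Complex.I_re, mul_zero, add_zero]

theorem coulomb_translate_self {g : Torus a → ℝ} (hg : MemLp g 2 (cellMeasure a))
    (y : Torus a) :
    coulomb (fun x => g (x - y)) (fun x => g (x - y)) = coulomb g g := by
  have h1 := hasSum_coulomb_self (memLp_translate hg y)
  simp only [coeffR_translate, norm_mul, norm_wave, one_mul] at h1
  exact mul_left_cancel₀ (cellVolume_pos a).ne' (h1.unique (hasSum_coulomb_self hg))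

theorem coulomb_add_mul_self {f g : Torus a → ℝ} (hf : MemLp f 2 (cellMeasure a))
    (hg : MemLp g 2 (cellMeasure a)) (c : ℝ) :
    coulomb (fun x => f x + c * g x) (fun x => f x + c * g x)
      = coulomb f f + 2 * c * coulomb f g + c ^ 2 * coulomb g g := by
  have hcg : MemLp (fun x => c * g x) 2 (cellMeasure a) := hg.const_mul c
  have hs : MemLp (fun x => f x + c * g x) 2 (cellMeasure a) := hf.add hcg
  rw [coulomb_add_left hf hcg hs, coulomb_add_right hf hf hcg, coulomb_add_right hcg hf hcg,
    coulomb_const_mul_left hg hf, coulomb_const_mul_left hg hcg, coulomb_const_mul_right,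
    coulomb_const_mul_right, coulomb_comm hg hf]
  ring

/-- If translating `g` does not lower the Coulomb energy of `f + g`, the force of `f + g` on `g`
vanishes. -/
theorem force_eq_zero {f g : Torus a → ℝ}
    (hf : MemLp f 2 (cellMeasure a)) (hg : MemLp g 2 (cellMeasure a))
    (hmin : ∀ y : Torus a, coulomb (fun x => f x + g x) (fun x => f x + g x)
      ≤ coulomb (fun x => f x + g (x - y)) (fun x => f x + g (x - y))) (i : Fin 3) :
    ∫ x, weakPartial a i (invNegLaplacian a (fun x => f x + g x)) x * (g x : ℂ)
      ∂(cellMeasure a) = 0 := by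
  have hV : (cellVolume a : ℂ) ≠ 0 := by exact_mod_cast (cellVolume_pos a).ne'
  have hfg : MemLp (fun x => f x + g x) 2 (cellMeasure a) := hf.add hg
  -- The self-energy of `g` is translation invariant, so only the cross term with `f` depends on
  -- `y`.
  have hexp : ∀ y : Torus a, coulomb (fun x => f x + g (x - y)) (fun x => f x + g (x - y))
      = coulomb f f + 2 * coulomb f (fun x => g (x - y)) + coulomb g g := fun y => by
    have := coulomb_add_mul_self hf (memLp_translate hg y) 1
    simp only [one_mul, mul_one, one_pow] at this
    rw [this, coulomb_translate_self hg]
  have hd := hasDerivAt_coulomb_translate i hf hg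
  have hloc : IsLocalMin (fun t : ℝ => cellVolume a * coulomb f
      (fun x => g (x - proj a (t • EuclideanSpace.single i (1 : ℝ))))) 0 := by
    refine Eventually.of_forall fun t => ?_
    have h1 := hmin (proj a (t • EuclideanSpace.single i (1 : ℝ)))
    have h2 := hexp 0
    simp only [sub_zero] at h2
    rw [hexp, h2] at h1
    refine mul_le_mul_of_nonneg_left ?_ (cellVolume_pos a).le
    simp only [zero_smul, proj_zero, sub_zero]
    linarith
  have hre := hloc.hasDerivAt_eq_zero hd
  have hS := hasSum_force i hfg hg
  -- Minimality gives the force of `f` alone on `g`; adding the self-force changes no real part.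
  have hre2 : (∑' n, forceTerm i (fun x => f x + g x) g n).re = 0 := by
    rw [Complex.re_tsum (summable_norm_forceTerm i hf hg).of_norm] at hre
    rw [Complex.re_tsum hS.summable, ← hre]
    exact tsum_congr fun n => forceTerm_add_self_re i hf hg n
  have h0 : ∑' n, forceTerm i (fun x => f x + g x) g n = 0 :=
    Complex.ext hre2 (tsum_forceTerm_im i _ _)
  rw [hS.tsum_eq] at h0
  exact (mul_eq_zero.mp h0).resolve_left hV

/-- The constraint involves only `ψ`, so a single ion may be moved freely. The charge is split into
that ion and everything else, and the kinetic term cancels. -/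
theorem newtonEq_of_isMinimiser {ħ m e : ℝ} {ρper : Fin N → Torus a → ℝ}
    (hρ : ∀ j, MemLp (ρper j) 2 (cellMeasure a)) {ψ : Torus a → ℂ} {X : Fin N → Torus a}
    (h : IsMinimiser ħ m e ρper ψ X) :
    NewtonEq (fun x => (invNegLaplacian a (chargeDensity e ρper ψ X) x).re) ρper X := by
  intro j i
  simp only [ofReal_re_invNegLaplacian]
  have hψ : MemSobolev a 1 ψ := h.1.1
  set f : Torus a → ℝ := fun x =>
    ∑ l ∈ Finset.univ.erase j, ρper l (x - X l) - e * ‖ψ x‖ ^ 2 with hf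
  have hfL : MemLp f 2 (cellMeasure a) :=
    (memLp_finsetSum _ fun l _ => memLp_translate (hρ l) (X l)).sub
      ((memLp_norm_sq hψ).const_mul e)
  have hsplit : ∀ y : Torus a, chargeDensity e ρper ψ (Function.update X j (X j + y))
      = fun x => f x + ρper j (x - y - X j) := fun y => by
    funext x
    simp only [chargeDensity, ionDensity, hf]
    rw [← Finset.add_sum_erase _ _ (Finset.mem_univ j), Function.update_self,
      Finset.sum_congr rfl fun l hl => by rw [Function.update_of_ne (Finset.ne_of_mem_erase hl)]]
    rw [sub_add_eq_sub_sub_swap]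
    ring
  have hsplit0 : chargeDensity e ρper ψ X = fun x => f x + ρper j (x - X j) := by
    have := hsplit 0
    simpa only [add_zero, Function.update_eq_self, sub_zero] using this
  have hg := memLp_translate (hρ j) (X j)
  have hzero := force_eq_zero hfL hg (fun y => by
    have h1 := h.2 (ψ, Function.update X j (X j + y)) ⟨hψ, h.1.2⟩
    rw [energy_eq hρ hψ, energy_eq hρ hψ, hsplit, hsplit0] at h1
    linarith) i
  rw [hsplit0, hzero, neg_zero]

end Newton

/-! ### The stationary Schrödinger equation -/

section Schrodinger

open Filter Topology ComplexConjugate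

variable {a : Module.Basis (Fin 3) ℝ Space} {N : ℕ}

theorem memSobolev_one_const_mul {u : Torus a → ℂ} (hu : MemSobolev a 1 u) (c : ℂ) :
    MemSobolev a 1 (fun x => c * u x) := by
  refine memSobolev_one_iff.mpr ⟨hu.1.const_mul c, ?_⟩
  refine ((memSobolev_one_iff.mp hu).2.mul_left (‖c‖ ^ 2)).congr fun n => ?_
  rw [coeff_const_mul, norm_mul]
  ring

/-- The Dirichlet integral `∫ |∇u|²`. -/
def dirichlet (u : Torus a → ℂ) : ℝ := ∫ x, ∑ j, ‖weakPartial a j u x‖ ^ 2 ∂(cellMeasure a)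

theorem dirichlet_const_mul {u : Torus a → ℂ} (hu : MemSobolev a 1 u) (c : ℂ) :
    dirichlet (fun x => c * u x) = ‖c‖ ^ 2 * dirichlet u := by
  have h1 := hasSum_gradient (memSobolev_one_const_mul hu c)
  have h2 := (hasSum_gradient hu).mul_left (‖c‖ ^ 2)
  have h3 := h1.unique (h2.congr_fun fun n => by
    rw [coeff_const_mul, norm_mul]
    ring)
  refine mul_left_cancel₀ (cellVolume_pos a).ne' (h3.trans ?_)
  rw [dirichlet]
  ring

theorem norm_add_real_mul_sq (y w : ℂ) (t : ℝ) :
    ‖y + t * w‖ ^ 2 = ‖y‖ ^ 2 + t * (2 * (conj w * y).re + t * ‖w‖ ^ 2) := by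
  rw [← Complex.normSq_eq_norm_sq, ← Complex.normSq_eq_norm_sq, ← Complex.normSq_eq_norm_sq]
  simp only [Complex.normSq_apply, Complex.add_re, Complex.add_im, Complex.mul_re, Complex.mul_im,
    Complex.ofReal_re, Complex.ofReal_im, Complex.conj_re, Complex.conj_im]
  ring

theorem coeff_add_wave {u : Torus a → ℂ} (hu : MemLp u 2 (cellMeasure a)) (z : ℂ)
    (l n : Fin 3 → ℤ) (t : ℝ) :
    coeff (fun x => u x + t * (z * wave a (-l) x)) n
      = coeff u n + t * (z * if n = l then (cellVolume a : ℂ) else 0) := by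
  rw [coeff_add (hu.integrable (by norm_num))
    (((integrable_of_continuous (continuous_wave a _)).const_mul z).const_mul _),
    coeff_const_mul, coeff_const_mul, coeff_wave]

/-- A one-wave perturbation changes a single Fourier coefficient, so the Dirichlet series changes in
one term, quadratically in `t`. -/
theorem hasSum_gradient_add_wave {u : Torus a → ℂ} (hu : MemSobolev a 1 u) (z : ℂ)
    (l : Fin 3 → ℤ) (t : ℝ) :
    HasSum (fun n => ‖dualPoint a n‖ ^ 2
        * ‖coeff (fun x => u x + t * (z * wave a (-l) x)) n‖ ^ 2)
      (cellVolume a * (dirichlet u + t * (2 * ‖dualPoint a l‖ ^ 2 * (conj z * coeff u l).re)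
        + t ^ 2 * (cellVolume a * ‖dualPoint a l‖ ^ 2 * ‖z‖ ^ 2))) := by
  have h1 := (hasSum_gradient hu).add (hasSum_ite_eq l
    (cellVolume a * (t * (2 * ‖dualPoint a l‖ ^ 2 * (conj z * coeff u l).re)
        + t ^ 2 * (cellVolume a * ‖dualPoint a l‖ ^ 2 * ‖z‖ ^ 2))))
  convert! h1 using 1
  · funext n
    rw [coeff_add_wave hu.1]
    split_ifs with hn
    · subst hn
      rw [norm_add_real_mul_sq, map_mul, Complex.conj_ofReal, norm_mul, Complex.norm_real,
        Real.norm_of_nonneg (cellVolume_pos a).le]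
      have : (conj z * cellVolume a * coeff u n).re
          = cellVolume a * (conj z * coeff u n).re := by
        rw [← Complex.re_ofReal_mul]
        ring_nf
      rw [this]
      ring
    · simp
  · rw [dirichlet]
    ring

theorem memSobolev_one_add_wave {u : Torus a → ℂ} (hu : MemSobolev a 1 u) (z : ℂ)
    (l : Fin 3 → ℤ) (t : ℝ) : MemSobolev a 1 (fun x => u x + t * (z * wave a (-l) x)) :=
  memSobolev_one_iff.mpr ⟨hu.1.add (((memLp_wave a _ 2).const_mul z).const_mul _),
    (hasSum_gradient_add_wave hu z l t).summable⟩

theorem dirichlet_add_wave {u : Torus a → ℂ} (hu : MemSobolev a 1 u) (z : ℂ)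
    (l : Fin 3 → ℤ) (t : ℝ) :
    dirichlet (fun x => u x + t * (z * wave a (-l) x))
      = dirichlet u + t * (2 * ‖dualPoint a l‖ ^ 2 * (conj z * coeff u l).re)
        + t ^ 2 * (cellVolume a * ‖dualPoint a l‖ ^ 2 * ‖z‖ ^ 2) :=
  mul_left_cancel₀ (cellVolume_pos a).ne'
    ((hasSum_gradient (memSobolev_one_add_wave hu z l t)).unique
      (hasSum_gradient_add_wave hu z l t))

theorem integral_quadratic {q₀ q₁ q₂ : Torus a → ℝ} (h₀ : Integrable q₀ (cellMeasure a))
    (h₁ : Integrable q₁ (cellMeasure a)) (h₂ : Integrable q₂ (cellMeasure a)) (t : ℝ) :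
    ∫ x, q₀ x + t * (q₁ x + t * q₂ x) ∂(cellMeasure a)
      = ∫ x, q₀ x ∂(cellMeasure a) + t * (∫ x, q₁ x ∂(cellMeasure a))
        + t ^ 2 * ∫ x, q₂ x ∂(cellMeasure a) := by
  have ht : Integrable (fun x => t * q₂ x) (cellMeasure a) := h₂.const_mul t
  have ht' : Integrable (fun x => t * (q₁ x + t * q₂ x)) (cellMeasure a) :=
    (h₁.add ht).const_mul t
  rw [integral_add h₀ ht', integral_const_mul, integral_add h₁ ht, integral_const_mul]
  ring

theorem coulomb_quadratic_right {f q₀ q₁ q₂ : Torus a → ℝ} (hf : MemLp f 2 (cellMeasure a))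
    (h₀ : MemLp q₀ 2 (cellMeasure a)) (h₁ : MemLp q₁ 2 (cellMeasure a))
    (h₂ : MemLp q₂ 2 (cellMeasure a)) (t : ℝ) :
    coulomb f (fun x => q₀ x + t * (q₁ x + t * q₂ x))
      = coulomb f q₀ + t * coulomb f q₁ + t ^ 2 * coulomb f q₂ := by
  have ht : MemLp (fun x => t * q₂ x) 2 (cellMeasure a) := h₂.const_mul t
  have ht' : MemLp (fun x => t * (q₁ x + t * q₂ x)) 2 (cellMeasure a) :=
    (h₁.add ht).const_mul t
  rw [coulomb_add_right hf h₀ ht', coulomb_const_mul_right, coulomb_add_right hf h₁ ht,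
    coulomb_const_mul_right]
  ring

theorem coulomb_quadratic_self {q₀ q₁ q₂ : Torus a → ℝ}
    (h₀ : MemLp q₀ 2 (cellMeasure a)) (h₁ : MemLp q₁ 2 (cellMeasure a))
    (h₂ : MemLp q₂ 2 (cellMeasure a)) (t : ℝ) :
    coulomb (fun x => q₀ x + t * (q₁ x + t * q₂ x)) (fun x => q₀ x + t * (q₁ x + t * q₂ x))
      = coulomb q₀ q₀ + t * (2 * coulomb q₀ q₁)
        + t ^ 2 * (2 * coulomb q₀ q₂ + coulomb q₁ q₁) + t ^ 3 * (2 * coulomb q₁ q₂)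
        + t ^ 4 * coulomb q₂ q₂ := by
  have ht : MemLp (fun x => t * q₂ x) 2 (cellMeasure a) := h₂.const_mul t
  have h₁₂ : MemLp (fun x => q₁ x + t * q₂ x) 2 (cellMeasure a) := h₁.add ht
  rw [coulomb_add_mul_self h₀ h₁₂, coulomb_add_right h₀ h₁ ht, coulomb_const_mul_right,
    coulomb_add_mul_self h₁ h₂]
  ring

/-- The energy of `(√s u, X)`. -/
def scaledEnergy (ħ m e : ℝ) (ρper : Fin N → Torus a → ℝ) (X : Fin N → Torus a)
    (u : Torus a → ℂ) (s : ℝ) : ℝ :=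
  ħ ^ 2 / (2 * m) * (s * dirichlet u)
    + 1 / 2 * (coulomb (ionDensity ρper X) (ionDensity ρper X)
      + 2 * (-(e * s)) * coulomb (ionDensity ρper X) (fun x => ‖u x‖ ^ 2)
      + (-(e * s)) ^ 2 * coulomb (fun x => ‖u x‖ ^ 2) (fun x => ‖u x‖ ^ 2))

/-- The energy sees `ψ` only through its Dirichlet integral and `|ψ|²`, both linear in `s`; this
makes renormalised variations explicit. -/
theorem energy_sqrt_mul {ρper : Fin N → Torus a → ℝ}
    (hρ : ∀ j, MemLp (ρper j) 2 (cellMeasure a)) (ħ m e : ℝ) (X : Fin N → Torus a)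
    {u : Torus a → ℂ} (hu : MemSobolev a 1 u) {s : ℝ} (hs : 0 ≤ s) :
    energy ħ m e ρper (fun x => (Real.sqrt s : ℂ) * u x) X = scaledEnergy ħ m e ρper X u s := by
  have hnorm : ‖(Real.sqrt s : ℂ)‖ ^ 2 = s := by
    rw [Complex.norm_real, Real.norm_eq_abs, sq_abs, Real.sq_sqrt hs]
  have hcharge : chargeDensity e ρper (fun x => (Real.sqrt s : ℂ) * u x) X
      = fun x => ionDensity ρper X x + (-(e * s)) * ‖u x‖ ^ 2 := by
    funext x
    rw [chargeDensity, norm_mul, mul_pow, hnorm]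
    ring
  rw [energy_eq hρ (memSobolev_one_const_mul hu _), scaledEnergy]
  rw [show ∫ x, ∑ j, ‖weakPartial a j (fun x => (Real.sqrt s : ℂ) * u x) x‖ ^ 2 ∂(cellMeasure a)
    = dirichlet (fun x => (Real.sqrt s : ℂ) * u x) from rfl, dirichlet_const_mul hu, hnorm,
    hcharge, coulomb_add_mul_self (memLp_ionDensity hρ X) (memLp_norm_sq hu)]

theorem hasDerivAt_quartic (c₀ c₁ c₂ c₃ c₄ : ℝ) :
    HasDerivAt (fun t : ℝ => c₀ + t * c₁ + t ^ 2 * c₂ + t ^ 3 * c₃ + t ^ 4 * c₄) c₁ 0 := by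
  have h := (((((hasDerivAt_id (0 : ℝ)).mul_const c₁).const_add c₀).add
    ((hasDerivAt_pow 2 (0 : ℝ)).mul_const c₂)).add ((hasDerivAt_pow 3 (0 : ℝ)).mul_const c₃)).add
    ((hasDerivAt_pow 4 (0 : ℝ)).mul_const c₄)
  convert! h using 1
  simp

/-- The first order condition for the energy along a normalised variation. -/
theorem stationary_of_isLocalMin {A e Z G K₁ K₂ n₁ n₂ b p₀ p₁ p₂ c₀ c₁ c₂ c₃ c₄ : ℝ}
    (hZ : 0 < Z)
    (h : IsLocalMin (fun t : ℝ =>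
      A * (Z / (Z + t * n₁ + t ^ 2 * n₂) * (G + t * K₁ + t ^ 2 * K₂))
        + 1 / 2 * (b + 2 * (-(e * (Z / (Z + t * n₁ + t ^ 2 * n₂)))) * (p₀ + t * p₁ + t ^ 2 * p₂)
          + (-(e * (Z / (Z + t * n₁ + t ^ 2 * n₂)))) ^ 2
            * (c₀ + t * c₁ + t ^ 2 * c₂ + t ^ 3 * c₃ + t ^ 4 * c₄))) 0) :
    A * K₁ - e * p₁ + e ^ 2 * c₁ / 2 = n₁ / Z * (A * G - e * p₀ + e ^ 2 * c₀) := by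
  have hquad : ∀ x₀ x₁ x₂ : ℝ, HasDerivAt (fun t : ℝ => x₀ + t * x₁ + t ^ 2 * x₂) x₁ 0 :=
    fun x₀ x₁ x₂ => by
      have := hasDerivAt_quartic x₀ x₁ x₂ 0 0
      simpa using this
  -- The rescaling factor `s(t) = Z / (Z + t n₁ + t² n₂)` has `s(0) = 1` and `s'(0) = -n₁ / Z`, the
  -- source of the multiplier term.
  have hs := (hasDerivAt_const (0 : ℝ) Z).div (hquad Z n₁ n₂) (by simpa using hZ.ne')
  have hes := (hs.const_mul e).neg
  have hd := ((hs.mul (hquad G K₁ K₂)).const_mul A).add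
    (((((hes.const_mul 2).mul (hquad p₀ p₁ p₂)).const_add b).add
      ((hes.pow 2).mul (hasDerivAt_quartic c₀ c₁ c₂ c₃ c₄))).const_mul (1 / 2))
  have h0 := h.hasDerivAt_eq_zero hd
  simp only [Pi.div_apply, Pi.neg_apply, Pi.pow_apply, zero_mul, add_zero, ne_eq,
    OfNat.ofNat_ne_zero, not_false_eq_true, zero_pow, div_self hZ.ne', Nat.cast_ofNat,
    Nat.add_one_sub_one, pow_one] at h0
  field_simp at h0 ⊢
  exact mul_left_cancel₀ hZ.ne' (by linear_combination h0)

theorem integral_two_re_conj_wave_mul {u : Torus a → ℂ} (hu : Integrable u (cellMeasure a))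
    (z : ℂ) (l : Fin 3 → ℤ) :
    ∫ x, 2 * (conj (z * wave a (-l) x) * u x).re ∂(cellMeasure a)
      = 2 * (conj z * coeff u l).re := by
  have h1 : ∀ x, conj (z * wave a (-l) x) * u x = conj z * (wave a l x * u x) := fun x => by
    rw [map_mul, wave_neg, Complex.conj_conj, mul_assoc]
  simp only [h1]
  rw [integral_const_mul, coeff, ← integral_const_mul (conj z)]
  congr 1
  exact integral_re ((integrable_wave_mul hu l).const_mul (conj z))

/-- The weak form of the Schrödinger equation on Fourier coefficients. -/
theorem schrodinger_coeff {ħ m e : ℝ} {ρper : Fin N → Torus a → ℝ}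
    (hρ : ∀ j, MemLp (ρper j) 2 (cellMeasure a)) (hZ : 0 < totalZ e ρper)
    {ψ : Torus a → ℂ} {X : Fin N → Torus a} (h : IsMinimiser ħ m e ρper ψ X)
    (l : Fin 3 → ℤ) :
    ((ħ ^ 2 / (2 * m) * ‖dualPoint a l‖ ^ 2 : ℝ) : ℂ) * coeff ψ l
      - e * coeff (fun x => invNegLaplacian a (chargeDensity e ρper ψ X) x * ψ x) l
      = (((ħ ^ 2 / (2 * m) * dirichlet ψ
          - e * coulomb (chargeDensity e ρper ψ X) (fun x => ‖ψ x‖ ^ 2)) / totalZ e ρper : ℝ) : ℂ)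
        * coeff ψ l := by
  set Z := totalZ e ρper with hZdef
  set A := ħ ^ 2 / (2 * m) with hA
  set σ := ionDensity ρper X with hσ
  set ρ := chargeDensity e ρper ψ X with hρdef
  have hψ : MemSobolev a 1 ψ := h.1.1
  have hψZ : ∫ x, ‖ψ x‖ ^ 2 ∂(cellMeasure a) = Z := h.1.2
  have hψi : Integrable ψ (cellMeasure a) := hψ.1.integrable (by norm_num)
  have hσL : MemLp σ 2 (cellMeasure a) := memLp_ionDensity hρ X
  have hρL : MemLp ρ 2 (cellMeasure a) := memLp_chargeDensity hρ hψ e X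
  set φ := invNegLaplacian a ρ with hφ
  have hφc : Continuous φ := continuous_invNegLaplacian hρL
  have hφψ : Integrable (fun x => φ x * ψ x) (cellMeasure a) := by
    obtain ⟨C, hC⟩ := isCompact_univ.exists_bound_of_continuousOn hφc.continuousOn
    exact hψi.bdd_mul hφc.aestronglyMeasurable (ae_of_all _ fun x => hC x (Set.mem_univ x))
  -- The Lagrange multiplier of the mass constraint, later `ħ` times the frequency.
  set Λ : ℝ := (A * dirichlet ψ - e * coulomb ρ (fun x => ‖ψ x‖ ^ 2)) / Z with hΛ
  set w : ℂ := ((A * ‖dualPoint a l‖ ^ 2 : ℝ) : ℂ) * coeff ψ l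
    - e * coeff (fun x => φ x * ψ x) l - (Λ : ℂ) * coeff ψ l with hw
  -- Minimality is a real condition; arbitrary complex directions `z` recover the complex equation,
  -- and `z = w` will force `w = 0`.
  have hkey : ∀ z : ℂ, (conj z * w).re = 0 := by
    intro z
    set q₀ : Torus a → ℝ := fun x => ‖ψ x‖ ^ 2 with hq₀
    set q₁ : Torus a → ℝ := fun x => 2 * (conj (z * wave a (-l) x) * ψ x).re with hq₁
    set q₂ : Torus a → ℝ := fun _ => ‖z‖ ^ 2 with hq₂
    have hq₀L : MemLp q₀ 2 (cellMeasure a) := memLp_norm_sq hψ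
    have hηψ : MemLp (fun x => conj (z * wave a (-l) x) * ψ x) 2 (cellMeasure a) := by
      have := (memLp_wave_mul hψ.1 l).const_mul (conj z)
      refine this.ae_eq (ae_of_all _ fun x => ?_)
      simp only [map_mul, wave_neg, Complex.conj_conj, mul_assoc]
    have hq₁L : MemLp q₁ 2 (cellMeasure a) := hηψ.re.const_mul 2
    have hq₂L : MemLp q₂ 2 (cellMeasure a) := memLp_const _
    set u : ℝ → Torus a → ℂ := fun t x => ψ x + t * (z * wave a (-l) x) with hu
    have huS : ∀ t, MemSobolev a 1 (u t) := fun t => memSobolev_one_add_wave hψ z l t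
    have husq : ∀ t, (fun x => ‖u t x‖ ^ 2) = fun x => q₀ x + t * (q₁ x + t * q₂ x) := fun t => by
      funext x
      simp only [hu, norm_add_real_mul_sq, hq₀, hq₁, hq₂]
      rw [norm_mul, norm_wave, mul_one]
    have hnormu : ∀ t, ∫ x, ‖u t x‖ ^ 2 ∂(cellMeasure a)
        = Z + t * (∫ x, q₁ x ∂(cellMeasure a)) + t ^ 2 * ∫ x, q₂ x ∂(cellMeasure a) := fun t => by
      rw [husq, integral_quadratic (hq₀L.integrable (by norm_num))
        (hq₁L.integrable (by norm_num)) (hq₂L.integrable (by norm_num)), hψZ]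
    have hcσ : ∀ t, coulomb σ (fun x => ‖u t x‖ ^ 2)
        = coulomb σ q₀ + t * coulomb σ q₁ + t ^ 2 * coulomb σ q₂ := fun t => by
      rw [husq, coulomb_quadratic_right hσL hq₀L hq₁L hq₂L]
    have hcu : ∀ t, coulomb (fun x => ‖u t x‖ ^ 2) (fun x => ‖u t x‖ ^ 2)
        = coulomb q₀ q₀ + t * (2 * coulomb q₀ q₁)
          + t ^ 2 * (2 * coulomb q₀ q₂ + coulomb q₁ q₁) + t ^ 3 * (2 * coulomb q₁ q₂)
          + t ^ 4 * coulomb q₂ q₂ := fun t => by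
      rw [husq, coulomb_quadratic_self hq₀L hq₁L hq₂L]
    set n₁ := ∫ x, q₁ x ∂(cellMeasure a) with hn₁
    set n₂ := ∫ x, q₂ x ∂(cellMeasure a) with hn₂
    have hE0 : energy ħ m e ρper ψ X = scaledEnergy ħ m e ρper X ψ 1 := by
      rw [← energy_sqrt_mul hρ ħ m e X hψ zero_le_one]
      simp
    have hpos : ∀ᶠ t : ℝ in 𝓝 0, 0 < Z + t * n₁ + t ^ 2 * n₂ := by
      have hc : Continuous fun t : ℝ => Z + t * n₁ + t ^ 2 * n₂ := by fun_prop
      have := hc.tendsto 0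
      refine this.eventually (lt_mem_nhds ?_)
      simpa using hZ
    have hJ : ∀ t : ℝ, scaledEnergy ħ m e ρper X (u t) (Z / (Z + t * n₁ + t ^ 2 * n₂))
        = A * (Z / (Z + t * n₁ + t ^ 2 * n₂)
            * (dirichlet ψ + t * (2 * ‖dualPoint a l‖ ^ 2 * (conj z * coeff ψ l).re)
              + t ^ 2 * (cellVolume a * ‖dualPoint a l‖ ^ 2 * ‖z‖ ^ 2)))
        + 1 / 2 * (coulomb σ σ + 2 * (-(e * (Z / (Z + t * n₁ + t ^ 2 * n₂))))
            * (coulomb σ q₀ + t * coulomb σ q₁ + t ^ 2 * coulomb σ q₂)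
          + (-(e * (Z / (Z + t * n₁ + t ^ 2 * n₂)))) ^ 2
            * (coulomb q₀ q₀ + t * (2 * coulomb q₀ q₁)
              + t ^ 2 * (2 * coulomb q₀ q₂ + coulomb q₁ q₁) + t ^ 3 * (2 * coulomb q₁ q₂)
              + t ^ 4 * coulomb q₂ q₂)) := fun t => by
      rw [scaledEnergy, hcσ, hcu, dirichlet_add_wave hψ]
    -- Near `t = 0` the varied function, rescaled by the square root of this factor, has mass `Z`
    -- and is an admissible competitor.
    have hmin : IsLocalMin (fun t : ℝ =>
        scaledEnergy ħ m e ρper X (u t) (Z / (Z + t * n₁ + t ^ 2 * n₂))) 0 := by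
      filter_upwards [hpos] with t ht
      have hs : 0 ≤ Z / (Z + t * n₁ + t ^ 2 * n₂) := by positivity
      have h0 : u 0 = ψ := by
        funext x
        simp [hu]
      simp only [zero_mul, add_zero, ne_eq, OfNat.ofNat_ne_zero, not_false_eq_true, zero_pow,
        div_self hZ.ne', h0]
      rw [← hE0, ← energy_sqrt_mul hρ ħ m e X (huS t) hs]
      refine h.2 (_, X) ⟨memSobolev_one_const_mul (huS t) _, ?_⟩
      simp only [norm_mul, mul_pow]
      rw [integral_const_mul, hnormu, Complex.norm_real, Real.norm_eq_abs, sq_abs,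
        Real.sq_sqrt hs, div_mul_cancel₀ _ ht.ne']
    simp only [hJ] at hmin
    have hst := stationary_of_isLocalMin hZ hmin
    have hn₁v : n₁ = 2 * (conj z * coeff ψ l).re := integral_two_re_conj_wave_mul hψi z l
    have hρσ : ρ = fun x => σ x + (-e) * q₀ x := by
      funext x
      rw [hρdef, chargeDensity]
      ring
    have hcρ : ∀ g : Torus a → ℝ, MemLp g 2 (cellMeasure a) →
        coulomb ρ g = coulomb σ g - e * coulomb q₀ g := fun g hg => by
      rw [hρσ, coulomb_add_left hσL (hq₀L.const_mul (-e)) hg, coulomb_const_mul_left hq₀L hg]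
      ring
    have hcρq₁ : coulomb ρ q₁ = 2 * (conj z * coeff (fun x => φ x * ψ x) l).re := by
      rw [← integral_two_re_conj_wave_mul hφψ, coulomb]
      congr 1 with x
      have h1 : conj (z * wave a (-l) x) * (φ x * ψ x)
          = ((φ x).re : ℂ) * (conj (z * wave a (-l) x) * ψ x) := by
        rw [hφ, ofReal_re_invNegLaplacian ρ x]
        ring
      rw [h1, Complex.re_ofReal_mul]
      simp only [hq₁, hφ]
      ring
    have hexp : (conj z * w).re = A * ‖dualPoint a l‖ ^ 2 * (conj z * coeff ψ l).re
        - e * (conj z * coeff (fun x => φ x * ψ x) l).re - Λ * (conj z * coeff ψ l).re := by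
      rw [← Complex.re_ofReal_mul, ← Complex.re_ofReal_mul, ← Complex.re_ofReal_mul,
        ← Complex.sub_re, ← Complex.sub_re, hw]
      congr 1
      ring
    have hΛ2 : Λ = (A * dirichlet ψ - e * coulomb σ q₀ + e ^ 2 * coulomb q₀ q₀) / Z := by
      rw [hΛ, hcρ q₀ hq₀L]
      ring
    have h1 := hcρ q₁ hq₁L
    rw [hcρq₁] at h1
    rw [hexp, hΛ2]
    rw [hn₁v] at hst
    linear_combination hst / 2 - e / 2 * h1
  have hw0 : w = 0 := by
    have h1 := hkey w
    rw [conj_mul_self_eq, Complex.ofReal_re] at h1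
    simpa using h1
  exact sub_eq_zero.mp hw0

/-- Neutrality of the cell: `e Z` is the total ionic charge, and translations preserve each ion's
share. -/
theorem integral_chargeDensity_eq_zero {e Z : ℝ} (he : e ≠ 0) {ρper : Fin N → Torus a → ℝ}
    (hρ : ∀ j, Integrable (ρper j) (cellMeasure a)) {ψ : Torus a → ℂ}
    (hψ : MemLp ψ 2 (cellMeasure a)) (hψZ : ∫ x, ‖ψ x‖ ^ 2 ∂(cellMeasure a) = Z)
    (hZ : Z = totalZ e ρper) (X : Fin N → Torus a) :
    ∫ x, chargeDensity e ρper ψ X x ∂(cellMeasure a) = 0 := by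
  have h1 : ∀ j, Integrable (fun x => ρper j (x - X j)) (cellMeasure a) := fun j =>
    (measurePreserving_sub a (X j)).integrable_comp_of_integrable (hρ j)
  simp only [chargeDensity, ionDensity]
  rw [integral_sub (integrable_finsetSum _ fun j _ => h1 j)
    ((hψ.integrable_norm_pow (by norm_num)).const_mul e), integral_finsetSum _ fun j _ => h1 j,
    integral_const_mul, hψZ, hZ, totalZ, Finset.mul_sum, sub_eq_zero]
  refine Finset.sum_congr rfl fun j _ => ?_
  rw [integral_sub_right_eq_self (ρper j) (X j), mul_div_cancel₀ _ he]

theorem stationary_equations_of_isMinimiser {ħ m e : ℝ} (hħ : 0 < ħ) (hm : 0 < m) (he : 0 < e)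
    {ρper : Fin N → Torus a → ℝ} (hρ : ∀ j, MemLp (ρper j) 2 (cellMeasure a))
    (hZ : 0 < totalZ e ρper) {ψ : Torus a → ℂ} {X : Fin N → Torus a}
    (h : IsMinimiser ħ m e ρper ψ X) :
    MemSobolev a 2 ψ ∧ ∃ (φ : Torus a → ℝ) (freq : ℝ),
      MemSobolev a 2 (fun x => (φ x : ℂ)) ∧ SchrodingerEq ħ m e freq φ ψ ∧
      PoissonEq φ (chargeDensity e ρper ψ X) ∧ NewtonEq φ ρper X := by
  have hψ : MemSobolev a 1 ψ := h.1.1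
  set ρ := chargeDensity e ρper ψ X with hρdef
  have hρL : MemLp ρ 2 (cellMeasure a) := memLp_chargeDensity hρ hψ e X
  have hA : 0 < ħ ^ 2 / (2 * m) := by positivity
  have hcoeff := schrodinger_coeff hρ hZ h
  set A := ħ ^ 2 / (2 * m) with hAdef
  set Λ : ℝ := (A * dirichlet ψ - e * coulomb ρ (fun x => ‖ψ x‖ ^ 2)) / totalZ e ρper
  set φ := invNegLaplacian a ρ with hφ
  have hφc : Continuous φ := continuous_invNegLaplacian hρL
  have hφψ : MemLp (fun x => φ x * ψ x) 2 (cellMeasure a) := by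
    obtain ⟨C, hC⟩ := isCompact_univ.exists_bound_of_continuousOn hφc.continuousOn
    refine hψ.1.of_le_mul (c := C) (hφc.aestronglyMeasurable.mul hψ.1.1) (ae_of_all _ fun x => ?_)
    rw [norm_mul]
    exact mul_le_mul_of_nonneg_right (hC x (Set.mem_univ x)) (norm_nonneg _)
  have hcoeff' : ∀ n, ((A * ‖dualPoint a n‖ ^ 2 : ℝ) : ℂ) * coeff ψ n
      = coeff (fun x => e * (φ x * ψ x) + Λ * ψ x) n := fun n => by
    rw [coeff_add ((hφψ.integrable (by norm_num)).const_mul _)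
      ((hψ.1.integrable (by norm_num)).const_mul _), coeff_const_mul, coeff_const_mul]
    linear_combination hcoeff n
  -- Elliptic regularity: `A |k|² ψ̂` are the coefficients of `e φ ψ + Λ ψ`, which is in `L²`
  -- because the continuous `φ` is bounded on the compact torus.
  have hψ2 : MemSobolev a 2 ψ := by
    have hL : MemLp (fun x => (e : ℂ) * (φ x * ψ x) + Λ * ψ x) 2 (cellMeasure a) :=
      (hφψ.const_mul _).add (hψ.1.const_mul _)
    refine memSobolev_two_of_summable hψ.1
      (((summable_norm_coeff_sq hL).mul_left ((A ^ 2)⁻¹)).congr fun n => ?_)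
    rw [← hcoeff' n, norm_mul, Complex.norm_real, Real.norm_of_nonneg (by positivity)]
    field_simp
  refine ⟨hψ2, fun x => (φ x).re, Λ / ħ, ?_, ?_, ?_, newtonEq_of_isMinimiser hρ h⟩
  · simp only [hφ, ofReal_re_invNegLaplacian]
    exact memSobolev_two_potential hρL
  · obtain ⟨hint, hlap⟩ := weakLaplacian_coeff hψ2
    have hint2 : Integrable (fun x => ((-A : ℝ) : ℂ) * weakLaplacian a ψ x
        - e * (φ x * ψ x)) (cellMeasure a) :=
      (hint.const_mul _).sub ((hφψ.integrable (by norm_num)).const_mul _)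
    have hint3 : Integrable (fun x => (Λ : ℂ) * ψ x) (cellMeasure a) :=
      (hψ.1.integrable (by norm_num)).const_mul _
    have hae := ae_eq_of_coeff_eq hint3 hint2 fun n => by
      rw [coeff_sub (hint.const_mul _) ((hφψ.integrable (by norm_num)).const_mul _),
        coeff_const_mul, coeff_const_mul, coeff_const_mul, hlap]
      have := hcoeff n
      push_cast at this ⊢
      linear_combination -this
    have hħ' : (ħ : ℂ) ≠ 0 := by exact_mod_cast hħ.ne'
    refine hae.mono fun x hx => ?_
    rw [hφ, ofReal_re_invNegLaplacian ρ x]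
    push_cast at hx ⊢
    rw [mul_div_cancel₀ _ hħ', hx, hAdef]
    push_cast
    ring
  · exact poissonEq_potential hρL (integral_chargeDensity_eq_zero he.ne'
      (fun j => (hρ j).integrable (by norm_num)) hψ.1 h.1.2 rfl X)

end Schrodinger

end Crystal

end

theorem mainTheorem5 (a : Module.Basis (Fin 3) ℝ Crystal.Space) (N : ℕ) (ħ m e : ℝ)
    (hħ : 0 < ħ) (hm : 0 < m) (he : 0 < e) (ρper : Fin N → Crystal.Torus a → ℝ)
    (hρ : ∀ j, MemLp (ρper j) 1 (Crystal.cellMeasure a) ∧ MemLp (ρper j) 2 (Crystal.cellMeasure a))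
    (hZ : 0 < Crystal.totalZ e ρper) :
    (∃ (ψ₀ : Crystal.Torus a → ℂ) (X₀ : Fin N → Crystal.Torus a),
      Crystal.IsMinimiser ħ m e ρper ψ₀ X₀) ∧
    ∀ (ψ₀ : Crystal.Torus a → ℂ) (X₀ : Fin N → Crystal.Torus a),
      Crystal.IsMinimiser ħ m e ρper ψ₀ X₀ →
        Crystal.MemSobolev a 2 ψ₀ ∧
        ∃ (φ₀ : Crystal.Torus a → ℝ) (ω₀ : ℝ),
          Crystal.MemSobolev a 2 (fun x => (φ₀ x : ℂ)) ∧
          Crystal.SchrodingerEq ħ m e ω₀ φ₀ ψ₀ ∧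
          Crystal.PoissonEq φ₀ (Crystal.chargeDensity e ρper ψ₀ X₀) ∧
          Crystal.NewtonEq φ₀ ρper X₀ := by
  have hρ2 : ∀ j, MemLp (ρper j) 2 (Crystal.cellMeasure a) := fun j => (hρ j).2
  exact ⟨Crystal.exists_isMinimiser hħ hm hρ2 hZ, fun _ _ h =>
    Crystal.stationary_equations_of_isMinimiser hħ hm he hρ2 hZ h⟩
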